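/- Let $n_x\ge 1$, $n_w,n_z\ge 0$, and let $x\in\mathbb R^{n_x}$, $w\in\mathbb R^{n_w}$, $z\in\mathbb R^{n_z}$ be jointly Gaussian random vectors with zero mean and positive-definite joint covariance matrix. Write $V_{ab}=\mathbb E\{ab^\top\}$. Fix $\delta\ge 0$. **The game.** A sender observes a random element $o$ from which $(x,w)$ can be measurably recovered (for instance $o=(x,w)$, or $o=(x,w,z)$ if the sender also has access to $z$) and draws a scalar message $y\in\mathbb R$ from $\gamma(\cdot\mid o)$. A receiver draws $\hat x\in\mathbb R^{n_x}$ from $\psi(\cdot\mid y,z)$, and a malicious agent draws $\hat w\in\mathbb R^{n_w}$ from $\phi(\cdot\mid y,z)$. Let $\Gamma,\Psi,\Phi$ be the sets of all such conditional probability distributions (Markov kernels, so that deterministic policies are included), and let $\Psi^\Gamma,\Phi^\Gamma$ be the sets of all maps from $\Gamma$ to $\Psi$ and to $\Phi$. Let $A(\gamma,\psi)=\mathbb E\|x-\hat x\|_2^2$ and $B(\gamma,\phi)=\mathbb E\|w-\hat w\|_2^2$ be the errors under these policies. A triple $(\psi^*,\phi^*,\gamma^*)\in\Psi^\Gamma\times\Phi^\Gamma\times\Gamma$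 is an *equilibrium* if $A(\gamma^*,\psi^*(\gamma^*))$ and $B(\gamma^*,\phi^*(\gamma^*))$ are finite, $\psi^*$ minimizes $A(\gamma^*,\psi(\gamma^*))$ over $\psi\in\Psi^\Gamma$, $\phi^*$ minimizes $B(\gamma^*,\phi(\gamma^*))$ over $\phi\in\Phi^\Gamma$, and $\gamma^*$ minimizes $A(\gamma,\psi^*(\gamma))-\delta B(\gamma,\phi^*(\gamma))$ over $\gamma\in\Gamma$. **Claim.** Let $$\Xi=\begin{pmatrix}V_{xx}&V_{xw}\\V_{wx}&V_{ww}\end{pmatrix}-\begin{pmatrix}V_{xz}\\V_{wz}\end{pmatrix}V_{zz}^{-1}\begin{pmatrix}V_{xz}\\V_{wz}\end{pmatrix}^{\top}.$$ The matrix $\Xi^{1/2}\,\mathrm{diag}(-I,\delta I)\,\Xi^{1/2}$ has a smallest eigenvalue, and for every unit eigenvector $\xi$ belonging to it there is an equilibrium $(\psi^*,\phi^*,\gamma^*)$ such that 1. for every $\gamma\in\Gamma$, the policies $\psi^*(\gamma)$ and $\phi^*(\gamma)$ are the linear minimum mean square error estimators for the message $y$ generated by $\gamma$: almost surely $$\hat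 x=\begin{pmatrix}V_{xy}&V_{xz}\end{pmatrix}\begin{pmatrix}V_{yy}&V_{yz}\\V_{zy}&V_{zz}\end{pmatrix}^{-1}\begin{pmatrix}y\\z\end{pmatrix},\qquad \hat w=\begin{pmatrix}V_{wy}&V_{wz}\end{pmatrix}\begin{pmatrix}V_{yy}&V_{yz}\\V_{zy}&V_{zz}\end{pmatrix}^{-1}\begin{pmatrix}y\\z\end{pmatrix}$$ if $\mathbb E y^2<\infty$ and the inverse exists, and $\hat x=V_{xz}V_{zz}^{-1}z$, $\hat w=V_{wz}V_{zz}^{-1}z$ otherwise; 2. under $\gamma^*$, $\mathbb E y^2<\infty$ and the inverse in 1 exists, and $\mathbb P\{y=K_x^\top x+K_w^\top w\}=1$, where $\begin{pmatrix}K_x\\K_w\end{pmatrix}=\Xi^{-1/2}\xi$; 3. for every real $\kappa\neq 0$, $(\psi^*,\phi^*,\kappa\gamma^*)$ is also an equilibrium, where $\kappa\gamma^*$ sends $\kappa y$ whenever $\gamma^*$ sends $y$. -/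

import Mathlib

open MeasureTheory ProbabilityTheory
open scoped ENNReal MatrixOrder

noncomputable section

namespace PrivacyGame

/-- Column vectors `ℝⁿ` with the Euclidean norm. -/
abbrev Vec (n : ℕ) : Type := EuclideanSpace ℝ (Fin n)

/-- A randomized policy: a conditional probability distribution on `B` given a point of `A`.
Point masses (deterministic policies) are included. -/
abbrev Policy (A B : Type*) [MeasurableSpace A] [MeasurableSpace B] : Type _ :=
  {κ : Kernel A B // IsMarkovKernel κ}

/-! ### The game

`x` is the state, `w` the private information, `z` the side information, `o` what the sender
observes. The sender draws its message `y` from `γ (o)`; the receiver draws `x̂` from `ψ (y, z)` and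
the malicious agent draws `ŵ` from `φ (y, z)`. -/

section Game

variable {Ω I Y : Type*} [MeasurableSpace Ω] [MeasurableSpace I] [MeasurableSpace Y]
variable {nx nw nz : ℕ}

/-- The estimation error `E ‖v - v̂‖²`, in `[0, ∞]`, of an agent that estimates the random vector `v`
by `v̂ ~ e (· | y, z)` from a message `y ~ γ (· | o)` and the side information `z`. -/
def estError {n : ℕ} (P : Measure Ω) (v : Ω → Vec n) (z : Ω → Vec nz) (o : Ω → I)
    (γ : Policy I Y) (e : Policy (Y × Vec nz) (Vec n)) : ℝ≥0∞ :=
  ∫⁻ ω, ∫⁻ y, ∫⁻ vh, ‖v ω - vh‖ₑ ^ 2 ∂(e.1 (y, z ω)) ∂(γ.1 (o ω)) ∂P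

/-- The cost of the sender, `E ‖x - x̂‖² - δ E ‖w - ŵ‖²`. -/
def senderCost (P : Measure Ω) (x : Ω → Vec nx) (w : Ω → Vec nw) (z : Ω → Vec nz) (o : Ω → I)
    (δ : ℝ) (γ : Policy I Y) (e : Policy (Y × Vec nz) (Vec nx))
    (f : Policy (Y × Vec nz) (Vec nw)) : EReal :=
  (estError P x z o γ e : EReal) - (δ : EReal) * (estError P w z o γ f : EReal)

/-- Equilibrium of the privacy game with privacy ratio `δ`. The receiver and the malicious agent
choose maps from sender policies to estimation policies. The costs at the equilibrium are
finite, so that the cost of the sender there is a genuine difference. -/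
structure IsEquilibrium (P : Measure Ω) (x : Ω → Vec nx) (w : Ω → Vec nw) (z : Ω → Vec nz)
    (o : Ω → I) (δ : ℝ) (ψ : Policy I Y → Policy (Y × Vec nz) (Vec nx))
    (φ : Policy I Y → Policy (Y × Vec nz) (Vec nw)) (γ : Policy I Y) : Prop where
  finite_receiver : estError P x z o γ (ψ γ) ≠ ∞
  finite_malicious : estError P w z o γ (φ γ) ≠ ∞
  receiver : ∀ ψ' : Policy I Y → Policy (Y × Vec nz) (Vec nx),
    estError P x z o γ (ψ γ) ≤ estError P x z o γ (ψ' γ)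
  malicious : ∀ φ' : Policy I Y → Policy (Y × Vec nz) (Vec nw),
    estError P w z o γ (φ γ) ≤ estError P w z o γ (φ' γ)
  sender : ∀ γ' : Policy I Y,
    senderCost P x w z o δ γ (ψ γ) (φ γ) ≤ senderCost P x w z o δ γ' (ψ γ') (φ γ')

/-- The policy that sends `k * y` whenever `γ` sends `y`. -/
def scale (k : ℝ) (γ : Policy I ℝ) : Policy I ℝ :=
  ⟨γ.1.map (fun y => k * y),
    haveI := γ.2
    Kernel.IsMarkovKernel.map γ.1 (measurable_const_mul k)⟩

end Game

/-! ### Second moments and linear estimators -/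

section Moments

variable {Ω I : Type*} [MeasurableSpace Ω] [MeasurableSpace I]

/-- The matrix `V_{fg} = E (f gᵀ)` of two random vectors. -/
def secondMoment {ι κ : Type*} (P : Measure Ω) (f : Ω → ι → ℝ) (g : Ω → κ → ℝ) : Matrix ι κ ℝ :=
  Matrix.of fun i j => ∫ ω, f ω i * g ω j ∂P

/-- The stacked vector `(x, w)`. -/
def stackXW {nx nw : ℕ} (x : Ω → Vec nx) (w : Ω → Vec nw) (ω : Ω) : Fin nx ⊕ Fin nw → ℝ :=
  Sum.elim (x ω) (w ω)

/-- The stacked vector `(x, w, z)`. -/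
def stackXWZ {nx nw nz : ℕ} (x : Ω → Vec nx) (w : Ω → Vec nw) (z : Ω → Vec nz) (ω : Ω) :
    (Fin nx ⊕ Fin nw) ⊕ Fin nz → ℝ :=
  Sum.elim (stackXW x w ω) (z ω)

/-- The stacked vector `(y, z)` of a scalar message and the side information. -/
def stackYZ {nz : ℕ} (y : ℝ) (z : Vec nz) : Unit ⊕ Fin nz → ℝ :=
  Sum.elim (fun _ => y) z

/-- The expectation of `f (ω, y)` when the message is `y ~ γ (· | o)`. -/
def msgExpect (P : Measure Ω) (o : Ω → I) (γ : Policy I ℝ) (f : Ω → ℝ → ℝ) : ℝ :=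
  ∫ ω, ∫ y, f ω y ∂(γ.1 (o ω)) ∂P

/-- The matrix `[V_yy, V_yz; V_zy, V_zz]`. -/
def obsMoment {nz : ℕ} (P : Measure Ω) (z : Ω → Vec nz) (o : Ω → I) (γ : Policy I ℝ) :
    Matrix (Unit ⊕ Fin nz) (Unit ⊕ Fin nz) ℝ :=
  Matrix.of fun i j => msgExpect P o γ fun ω y => stackYZ y (z ω) i * stackYZ y (z ω) j

/-- The matrix `[V_vy, V_vz]`. -/
def crossMoment {n nz : ℕ} (P : Measure Ω) (v : Ω → Vec n) (z : Ω → Vec nz) (o : Ω → I)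
    (γ : Policy I ℝ) : Matrix (Fin n) (Unit ⊕ Fin nz) ℝ :=
  Matrix.of fun i j => msgExpect P o γ fun ω y => v ω i * stackYZ y (z ω) j

/-- `E y² < ∞` and `[V_yy, V_yz; V_zy, V_zz]` is invertible. -/
def IsRegular {nz : ℕ} (P : Measure Ω) (z : Ω → Vec nz) (o : Ω → I) (γ : Policy I ℝ) : Prop :=
  ∫⁻ ω, ∫⁻ y, ‖y‖ₑ ^ 2 ∂(γ.1 (o ω)) ∂P ≠ ∞ ∧ IsUnit (obsMoment P z o γ).det

open Classical in
/-- The linear minimum mean square error estimate of `v` from `(y, z)`, when the sender uses `γ`: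
`[V_vy, V_vz] [V_yy, V_yz; V_zy, V_zz]⁻¹ (y, z)`.
If `E y² = ∞` (a linear estimator of finite error cannot use `y`) or the inverse does not exist
(`y` is a linear function of `z`), the best linear estimate is `V_vz V_zz⁻¹ z`. -/
def lmmse {n nz : ℕ} (P : Measure Ω) (v : Ω → Vec n) (z : Ω → Vec nz) (o : Ω → I)
    (γ : Policy I ℝ) (q : ℝ × Vec nz) : Vec n :=
  if IsRegular P z o γ then
    WithLp.toLp 2 ((crossMoment P v z o γ * (obsMoment P z o γ)⁻¹).mulVec (stackYZ q.1 q.2))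
  else
    WithLp.toLp 2 ((secondMoment P (fun ω => (v ω).ofLp) (fun ω => (z ω).ofLp) *
      (secondMoment P (fun ω => (z ω).ofLp) (fun ω => (z ω).ofLp))⁻¹).mulVec q.2.ofLp)

/-- The matrix
`Ξ = [V_xx, V_xw; V_wx, V_ww] - [V_xz; V_wz] V_zz⁻¹ [V_xz; V_wz]ᵀ`. -/
def Xi {nx nw nz : ℕ} (P : Measure Ω) (x : Ω → Vec nx) (w : Ω → Vec nw) (z : Ω → Vec nz) :
    Matrix (Fin nx ⊕ Fin nw) (Fin nx ⊕ Fin nw) ℝ :=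
  secondMoment P (stackXW x w) (stackXW x w) -
    secondMoment P (stackXW x w) (fun ω => (z ω).ofLp) *
      (secondMoment P (fun ω => (z ω).ofLp) (fun ω => (z ω).ofLp))⁻¹ *
      (secondMoment P (stackXW x w) (fun ω => (z ω).ofLp)).transpose

end Moments

/-- The matrix `S^{1/2} diag(-I, δ I) S^{1/2}`. -/
def privacyMatrix {nx nw : ℕ} (S : Matrix (Fin nx ⊕ Fin nw) (Fin nx ⊕ Fin nw) ℝ) (δ : ℝ) :
    Matrix (Fin nx ⊕ Fin nw) (Fin nx ⊕ Fin nw) ℝ :=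
  CFC.sqrt S *
    Matrix.fromBlocks (-1 : Matrix (Fin nx) (Fin nx) ℝ) 0 0 (δ • (1 : Matrix (Fin nw) (Fin nw) ℝ)) *
    CFC.sqrt S

/-- `ξ` has Euclidean norm one and is an eigenvector of `M` for the smallest eigenvalue of `M`. -/
def IsNormalizedMinEigenvector {ι : Type*} [Fintype ι] [DecidableEq ι] (M : Matrix ι ι ℝ)
    (ξ : ι → ℝ) : Prop :=
  ξ ⬝ᵥ ξ = 1 ∧ ∃ l : ℝ,
    IsLeast {m : ℝ | Module.End.HasEigenvalue (Matrix.toLin' M) m} l ∧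
    Module.End.HasEigenvector (Matrix.toLin' M) l ξ

end PrivacyGame

end

/-! Let `D = diag(-I, δ I)`. Under the joint law of the sample point and the message `y`, regress
`(x, w)` and `y` on `z`; let `C` be the cross-covariance of the residuals and `s` the variance of
the residual of `y`. The linear estimators leave `(x, w)` with error moment `Ξ - C s⁻¹ Cᵀ`, and
the cost of the sender is minus the trace of `D` times this moment, so it exceeds the cost of an
uninformative message by `Cᵀ D C / s`. Positive semidefiniteness of `[Ξ, C; Cᵀ, s]` gives
`Cᵀ Ξ⁻¹ C ≤ s`, and the smallest eigenvalue `l` of `Ξ^{1/2} D Ξ^{1/2}` is negative because `D` is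
negative on `x`; hence `Cᵀ D C / s ≥ l Cᵀ Ξ⁻¹ C / s ≥ l`. Equality holds for
`y = k ξᵀ Ξ^{-1/2} (x, w)`. For such a message `(x, w, y, z)` is Gaussian, so the error of the
linear estimator is independent of `(y, z)` and no randomized estimator does better. -/

noncomputable section

namespace PrivacyGame

open Matrix

/-! ### Symmetric matrices and Schur complements -/

section Eigenvalues

variable {ι : Type*} [Fintype ι] [DecidableEq ι]

theorem hasEigenvalue_toLin'_iff_mem_spectrum {M : Matrix ι ι ℝ} {m : ℝ} :
    Module.End.HasEigenvalue (Matrix.toLin' M) m ↔ m ∈ spectrum ℝ M := by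
  rw [Module.End.hasEigenvalue_iff_mem_spectrum, spectrum_toLin']

theorem exists_isNormalizedMinEigenvector [Nonempty ι] {M : Matrix ι ι ℝ} (hM : M.IsHermitian) :
    ∃ ξ, IsNormalizedMinEigenvector M ξ := by
  obtain ⟨i, hi⟩ := Finite.exists_min hM.eigenvalues
  have hunit : (hM.eigenvectorBasis i).ofLp ⬝ᵥ (hM.eigenvectorBasis i).ofLp = 1 := by
    rw [← star_trivial (hM.eigenvectorBasis i).ofLp, dotProduct_comm,
      ← EuclideanSpace.inner_eq_star_dotProduct]
    exact inner_self_eq_one_of_norm_eq_one (hM.eigenvectorBasis.norm_eq_one i)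
  refine ⟨_, hunit, hM.eigenvalues i, ⟨?_, fun m hm => ?_⟩, ?_⟩
  · exact hasEigenvalue_toLin'_iff_mem_spectrum.2 (hM.eigenvalues_mem_spectrum_real i)
  · have hm' := hasEigenvalue_toLin'_iff_mem_spectrum.1 hm
    rw [hM.spectrum_real_eq_range_eigenvalues] at hm'
    obtain ⟨j, rfl⟩ := hm'
    exact hi j
  · refine ⟨Module.End.mem_eigenspace_iff.2 ?_, fun h => by simp [h] at hunit⟩
    rw [toLin'_apply]
    exact hM.mulVec_eigenvectorBasis i

theorem mul_dotProduct_self_le_dotProduct_mulVec {M : Matrix ι ι ℝ} (hM : M.IsHermitian) {l : ℝ}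
    (hl : l ∈ lowerBounds {m : ℝ | Module.End.HasEigenvalue (Matrix.toLin' M) m}) (a : ι → ℝ) :
    l * (a ⬝ᵥ a) ≤ a ⬝ᵥ M *ᵥ a := by
  have hle : algebraMap ℝ (Matrix ι ι ℝ) l ≤ M :=
    (algebraMap_le_iff_le_spectrum (a := M) hM).2 fun m hm =>
      hl (hasEigenvalue_toLin'_iff_mem_spectrum.2 hm)
  have h := (Matrix.le_iff.1 hle).dotProduct_mulVec_nonneg a
  rw [star_trivial, Algebra.algebraMap_eq_smul_one, sub_mulVec, smul_mulVec, one_mulVec,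
    dotProduct_sub, dotProduct_smul, smul_eq_mul] at h
  linarith

theorem isHermitian_sqrt (S : Matrix ι ι ℝ) : (CFC.sqrt S).IsHermitian :=
  (nonneg_iff_posSemidef.1 (CFC.sqrt_nonneg S)).isHermitian

theorem isHermitian_sqrt_mul_mul_sqrt (S : Matrix ι ι ℝ) {D : Matrix ι ι ℝ} (hD : D.IsHermitian) :
    (CFC.sqrt S * D * CFC.sqrt S).IsHermitian := by
  simpa only [(isHermitian_sqrt S).eq] using isHermitian_mul_mul_conjTranspose (CFC.sqrt S) hD

theorem sqrt_mul_sqrt_self {S : Matrix ι ι ℝ} (hS : S.PosDef) : CFC.sqrt S * CFC.sqrt S = S :=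
  CFC.sqrt_mul_sqrt_self S (nonneg_iff_posSemidef.2 hS.posSemidef)

theorem isUnit_det_sqrt {S : Matrix ι ι ℝ} (hS : S.PosDef) : IsUnit (CFC.sqrt S).det :=
  (isUnit_iff_isUnit_det _).1 <|
    (CFC.isUnit_sqrt_iff S (nonneg_iff_posSemidef.2 hS.posSemidef)).2 hS.isUnit

theorem mulVec_inv_sqrt_mulVec {S : Matrix ι ι ℝ} (hS : S.PosDef) (a : ι → ℝ) :
    S *ᵥ (CFC.sqrt S)⁻¹ *ᵥ a = CFC.sqrt S *ᵥ a := by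
  nth_rw 1 [← sqrt_mul_sqrt_self hS]
  rw [mulVec_mulVec, mul_nonsing_inv_cancel_right _ _ (isUnit_det_sqrt hS)]

theorem inv_sqrt_mulVec_dotProduct_sqrt_mulVec {S : Matrix ι ι ℝ} (hS : S.PosDef) (a b : ι → ℝ) :
    ((CFC.sqrt S)⁻¹ *ᵥ a) ⬝ᵥ (CFC.sqrt S *ᵥ b) = a ⬝ᵥ b := by
  have hR : (CFC.sqrt S)ᵀ = CFC.sqrt S := isHermitian_sqrt S
  rw [dotProduct_mulVec, ← mulVec_transpose, hR, mulVec_mulVec,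
    mul_nonsing_inv _ (isUnit_det_sqrt hS), one_mulVec]

theorem smul_inv_sqrt_mulVec_dotProduct_mulVec {S : Matrix ι ι ℝ} (hS : S.PosDef) (k : ℝ)
    (a : ι → ℝ) :
    (k • (CFC.sqrt S)⁻¹ *ᵥ a) ⬝ᵥ S *ᵥ (k • (CFC.sqrt S)⁻¹ *ᵥ a) = k * k * (a ⬝ᵥ a) := by
  rw [mulVec_smul, mulVec_inv_sqrt_mulVec hS, smul_dotProduct, dotProduct_smul,
    inv_sqrt_mulVec_dotProduct_sqrt_mulVec hS, smul_eq_mul, smul_eq_mul, mul_assoc]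

theorem dotProduct_sqrt_mul_mul_sqrt_mulVec (S D : Matrix ι ι ℝ) (a : ι → ℝ) :
    a ⬝ᵥ (CFC.sqrt S * D * CFC.sqrt S) *ᵥ a =
      (CFC.sqrt S *ᵥ a) ⬝ᵥ D *ᵥ (CFC.sqrt S *ᵥ a) := by
  have hR : (CFC.sqrt S)ᵀ = CFC.sqrt S := isHermitian_sqrt S
  rw [← mulVec_mulVec, ← mulVec_mulVec, dotProduct_mulVec a, ← mulVec_transpose, hR]

variable {S D : Matrix ι ι ℝ} {l : ℝ}

theorem mul_dotProduct_inv_mulVec_le (hS : S.PosDef) (hD : D.IsHermitian)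
    (hl : l ∈ lowerBounds {m : ℝ |
      Module.End.HasEigenvalue (Matrix.toLin' (CFC.sqrt S * D * CFC.sqrt S)) m}) (c : ι → ℝ) :
    l * (c ⬝ᵥ S⁻¹ *ᵥ c) ≤ c ⬝ᵥ D *ᵥ c := by
  have hR : (CFC.sqrt S)ᵀ = CFC.sqrt S := isHermitian_sqrt S
  have hc : CFC.sqrt S *ᵥ (CFC.sqrt S)⁻¹ *ᵥ c = c := by
    rw [mulVec_mulVec, mul_nonsing_inv _ (isUnit_det_sqrt hS), one_mulVec]
  have hinv : c ⬝ᵥ S⁻¹ *ᵥ c = ((CFC.sqrt S)⁻¹ *ᵥ c) ⬝ᵥ ((CFC.sqrt S)⁻¹ *ᵥ c) := by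
    nth_rw 1 [← sqrt_mul_sqrt_self hS]
    rw [Matrix.mul_inv_rev, ← mulVec_mulVec, dotProduct_mulVec, ← mulVec_transpose,
      transpose_nonsing_inv, hR]
  have h := mul_dotProduct_self_le_dotProduct_mulVec (isHermitian_sqrt_mul_mul_sqrt S hD) hl
    ((CFC.sqrt S)⁻¹ *ᵥ c)
  rwa [dotProduct_sqrt_mul_mul_sqrt_mulVec, hc, ← hinv] at h

theorem neg_of_dotProduct_mulVec_neg (hS : S.PosDef) (hD : D.IsHermitian)
    (hl : l ∈ lowerBounds {m : ℝ |
      Module.End.HasEigenvalue (Matrix.toLin' (CFC.sqrt S * D * CFC.sqrt S)) m})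
    {c : ι → ℝ} (hc : c ⬝ᵥ D *ᵥ c < 0) : l < 0 :=
  neg_of_mul_neg_left ((mul_dotProduct_inv_mulVec_le hS hD hl c).trans_lt hc)
    (hS.inv.posSemidef.dotProduct_mulVec_nonneg c)

theorem dotProduct_mulVec_sqrt_mulVec_eq {ξ : ι → ℝ} (hunit : ξ ⬝ᵥ ξ = 1)
    (hξ : Module.End.HasEigenvector (Matrix.toLin' (CFC.sqrt S * D * CFC.sqrt S)) l ξ) :
    (CFC.sqrt S *ᵥ ξ) ⬝ᵥ D *ᵥ (CFC.sqrt S *ᵥ ξ) = l := by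
  have h := hξ.apply_eq_smul
  rw [toLin'_apply] at h
  rw [← dotProduct_sqrt_mul_mul_sqrt_mulVec, h, dotProduct_smul, hunit, smul_eq_mul, mul_one]

end Eigenvalues

section Schur

theorem posDef_schurComplement {ι κ : Type*} [Finite ι] [Fintype κ] [DecidableEq κ]
    {A : Matrix ι ι ℝ} {B : Matrix ι κ ℝ} {D : Matrix κ κ ℝ}
    (h : (Matrix.fromBlocks A B Bᵀ D).PosDef) : (A - B * D⁻¹ * Bᵀ).PosDef := by
  classical
  have := Fintype.ofFinite ι
  have hD : D.PosDef := h.submatrix (e := Sum.inr) Sum.inr_injective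
  have : Invertible D := hD.isUnit.invertible
  have hpos : (A - B * D⁻¹ * Bᵀ).PosSemidef := by
    simpa only [conjTranspose_eq_transpose_of_trivial] using
      (PosDef.fromBlocks₂₂ A B hD).1 h.posSemidef
  refine hpos.posDef_iff_isUnit.2 ((isUnit_iff_isUnit_det _).2 (isUnit_iff_ne_zero.2 fun h0 => ?_))
  refine h.det_pos.ne' ?_
  rw [det_fromBlocks₂₂, invOf_eq_nonsing_inv, h0, mul_zero]

variable {ι : Type*} [Fintype ι]

theorem col_dotProduct_inv_mulVec_col_le [DecidableEq ι] {S : Matrix ι ι ℝ} {C : Matrix ι Unit ℝ}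
    {s : Matrix Unit Unit ℝ} (hS : S.PosDef) (h : (Matrix.fromBlocks S C Cᵀ s).PosSemidef) :
    C.col () ⬝ᵥ S⁻¹ *ᵥ C.col () ≤ s () () := by
  have : Invertible S := hS.isUnit.invertible
  have hschur := ((PosDef.fromBlocks₁₁ C s hS).1 h).diag_nonneg (i := ())
  rwa [conjTranspose_eq_transpose_of_trivial, Matrix.mul_assoc, Matrix.sub_apply,
    sub_nonneg] at hschur

theorem trace_mul_mul_inv_mul_transpose (D : Matrix ι ι ℝ) (C : Matrix ι Unit ℝ)
    (s : Matrix Unit Unit ℝ) :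
    (D * (C * s⁻¹ * Cᵀ)).trace = (C.col () ⬝ᵥ D *ᵥ C.col ()) / s () () := by
  have hcol : (Cᵀ * (D * C)) () () = C.col () ⬝ᵥ D *ᵥ C.col () := rfl
  rw [← Matrix.mul_assoc, trace_mul_comm, ← Matrix.mul_assoc, ← Matrix.mul_assoc,
    Matrix.mul_assoc Cᵀ, inv_subsingleton, ← hcol, div_eq_mul_inv]
  simp only [trace, diag_apply, Finset.univ_unique, Finset.sum_singleton, mul_diagonal,
    Ring.inverse_eq_inv', PUnit.default_eq_unit]

theorem le_trace_mul_mul_inv_mul_transpose [DecidableEq ι] {S D : Matrix ι ι ℝ}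
    {C : Matrix ι Unit ℝ} {s : Matrix Unit Unit ℝ} {l : ℝ} (hS : S.PosDef) (hD : D.IsHermitian)
    (hl : l ∈ lowerBounds {m : ℝ |
      Module.End.HasEigenvalue (Matrix.toLin' (CFC.sqrt S * D * CFC.sqrt S)) m}) (hl0 : l ≤ 0)
    (h : (Matrix.fromBlocks S C Cᵀ s).PosSemidef) (hs : 0 < s () ()) :
    l ≤ (D * (C * s⁻¹ * Cᵀ)).trace := by
  rw [trace_mul_mul_inv_mul_transpose, le_div_iff₀ hs]
  calc l * s () () ≤ l * (C.col () ⬝ᵥ S⁻¹ *ᵥ C.col ()) :=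
        mul_le_mul_of_nonpos_left (col_dotProduct_inv_mulVec_col_le hS h) hl0
    _ ≤ C.col () ⬝ᵥ D *ᵥ C.col () := mul_dotProduct_inv_mulVec_le hS hD hl _

end Schur

/-! ### Second moments and linear regression -/

section SecondMoment

variable {Ω Ω' : Type*} [MeasurableSpace Ω] [MeasurableSpace Ω'] {P : Measure Ω'} {Q : Measure Ω}
variable {ι κ τ : Type*}

theorem secondMoment_transpose (Q : Measure Ω) (f : Ω → ι → ℝ) (g : Ω → κ → ℝ) :
    (secondMoment Q f g)ᵀ = secondMoment Q g f := by
  ext i j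
  simp only [secondMoment, transpose_apply, of_apply, mul_comm]

theorem secondMoment_congr {f f' : Ω → ι → ℝ} {g g' : Ω → κ → ℝ} (hf : f =ᵐ[Q] f')
    (hg : g =ᵐ[Q] g') : secondMoment Q f g = secondMoment Q f' g' := by
  ext i j
  refine integral_congr_ae ?_
  filter_upwards [hf, hg] with ω hfω hgω
  rw [hfω, hgω]

theorem secondMoment_sumElim (Q : Measure Ω) (f : Ω → ι → ℝ) (g : Ω → κ → ℝ) :
    secondMoment Q (fun ω => Sum.elim (f ω) (g ω)) (fun ω => Sum.elim (f ω) (g ω)) =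
      fromBlocks (secondMoment Q f f) (secondMoment Q f g) (secondMoment Q g f)
        (secondMoment Q g g) := by
  ext (i | i) (j | j) <;> rfl

variable [Fintype ι] [Fintype κ]

theorem integrable_eval_mul_eval {f : Ω → ι → ℝ} {g : Ω → κ → ℝ} (hf : MemLp f 2 Q)
    (hg : MemLp g 2 Q) (i : ι) (j : κ) : Integrable (fun ω => f ω i * g ω j) Q :=
  (hf.eval i).integrable_mul (hg.eval j)

theorem memLp_mulVec (A : Matrix ι κ ℝ) {f : Ω → κ → ℝ} (hf : MemLp f 2 Q) :
    MemLp (fun ω => A *ᵥ f ω) 2 Q :=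
  (LinearMap.toContinuousLinearMap (mulVecLin A)).comp_memLp' hf

theorem integral_mulVec (A : Matrix ι κ ℝ) {f : Ω → κ → ℝ} (hf : Integrable f Q) :
    ∫ ω, A *ᵥ f ω ∂Q = A *ᵥ ∫ ω, f ω ∂Q :=
  (LinearMap.toContinuousLinearMap (mulVecLin A)).integral_comp_comm hf

theorem memLp_sumElim {f : Ω → ι → ℝ} {g : Ω → κ → ℝ} (hf : MemLp f 2 Q) (hg : MemLp g 2 Q) :
    MemLp (fun ω => Sum.elim (f ω) (g ω)) 2 Q :=
  memLp_pi_iff.2 <| Sum.rec (memLp_pi_iff.1 hf) (memLp_pi_iff.1 hg)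

theorem secondMoment_comp_measurePreserving {π : Ω → Ω'} (hπ : MeasurePreserving π Q P)
    {f : Ω' → ι → ℝ} {g : Ω' → κ → ℝ} (hf : MemLp f 2 P) (hg : MemLp g 2 P) :
    secondMoment Q (f ∘ π) (g ∘ π) = secondMoment P f g := by
  ext i j
  have hfg := (integrable_eval_mul_eval hf hg i j).aestronglyMeasurable
  rw [← hπ.map_eq] at hfg
  simp only [secondMoment, of_apply, ← hπ.map_eq, integral_map hπ.aemeasurable hfg,
    Function.comp_apply]

theorem secondMoment_sub_left {f f' : Ω → ι → ℝ} {g : Ω → κ → ℝ} (hf : MemLp f 2 Q)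
    (hf' : MemLp f' 2 Q) (hg : MemLp g 2 Q) :
    secondMoment Q (fun ω => f ω - f' ω) g = secondMoment Q f g - secondMoment Q f' g := by
  ext i j
  simp only [secondMoment, of_apply, Matrix.sub_apply, Pi.sub_apply, sub_mul]
  exact integral_sub (integrable_eval_mul_eval hf hg i j) (integrable_eval_mul_eval hf' hg i j)

theorem secondMoment_sub_right {f : Ω → ι → ℝ} {g g' : Ω → κ → ℝ} (hf : MemLp f 2 Q)
    (hg : MemLp g 2 Q) (hg' : MemLp g' 2 Q) :
    secondMoment Q f (fun ω => g ω - g' ω) = secondMoment Q f g - secondMoment Q f g' := by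
  rw [← secondMoment_transpose, secondMoment_sub_left hg hg' hf, transpose_sub,
    secondMoment_transpose, secondMoment_transpose]

theorem secondMoment_mulVec_left (A : Matrix τ ι ℝ) {f : Ω → ι → ℝ} {g : Ω → κ → ℝ}
    (hf : MemLp f 2 Q) (hg : MemLp g 2 Q) :
    secondMoment Q (fun ω => A *ᵥ f ω) g = A * secondMoment Q f g := by
  ext i j
  simp only [secondMoment, of_apply, mul_apply, mulVec, dotProduct, Finset.sum_mul, mul_assoc]
  rw [integral_finsetSum _ fun k _ => (integrable_eval_mul_eval hf hg k j).const_mul _]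
  simp only [integral_const_mul]

theorem secondMoment_mulVec_right (A : Matrix τ ι ℝ) {f : Ω → ι → ℝ} {g : Ω → κ → ℝ}
    (hf : MemLp f 2 Q) (hg : MemLp g 2 Q) :
    secondMoment Q g (fun ω => A *ᵥ f ω) = secondMoment Q g f * Aᵀ := by
  rw [← secondMoment_transpose, secondMoment_mulVec_left A hf hg, transpose_mul,
    secondMoment_transpose]

theorem posSemidef_secondMoment_self {f : Ω → ι → ℝ} (hf : MemLp f 2 Q) :
    (secondMoment Q f f).PosSemidef := by
  refine PosSemidef.of_dotProduct_mulVec_nonneg (secondMoment_transpose Q f f) fun a => ?_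
  have hquad : star a ⬝ᵥ secondMoment Q f f *ᵥ a =
    secondMoment Q (fun ω => replicateRow Unit a *ᵥ f ω) (fun ω => replicateRow Unit a *ᵥ f ω)
      () () := by
    rw [secondMoment_mulVec_left _ hf (memLp_mulVec _ hf), secondMoment_mulVec_right _ hf hf]
    rfl
  rw [hquad]
  exact integral_nonneg fun ω => mul_self_nonneg _

theorem lintegral_enorm_sq_eq_ofReal_integral {E : Type*} [NormedAddCommGroup E] {u : Ω → E}
    (hu : MemLp u 2 Q) : ∫⁻ ω, ‖u ω‖ₑ ^ 2 ∂Q = ENNReal.ofReal (∫ ω, ‖u ω‖ ^ 2 ∂Q) := by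
  rw [ofReal_integral_eq_lintegral_ofReal hu.norm.integrable_sq (.of_forall fun ω => sq_nonneg _)]
  simp_rw [ENNReal.ofReal_pow (norm_nonneg _), ofReal_norm]

theorem lintegral_enorm_sq_eq_trace_secondMoment {n : ℕ} {e : Ω → Vec n} (he : MemLp e 2 Q) :
    ∫⁻ ω, ‖e ω‖ₑ ^ 2 ∂Q =
      ENNReal.ofReal (secondMoment Q (fun ω => (e ω).ofLp) (fun ω => (e ω).ofLp)).trace := by
  rw [lintegral_enorm_sq_eq_ofReal_integral he]
  simp_rw [EuclideanSpace.real_norm_sq_eq, pow_two]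
  exact congrArg ENNReal.ofReal
    (integral_finsetSum _ fun i _ => (he.eval_piLp i).integrable_mul (he.eval_piLp i))

end SecondMoment

section Residual

variable {Ω Ω' : Type*} [MeasurableSpace Ω] [MeasurableSpace Ω'] {P : Measure Ω'} {Q : Measure Ω}
variable {ι κ σ τ : Type*} [Fintype τ] [DecidableEq τ]

/-- The residual of the linear regression (without intercept) of the random vector `f` on `z`. -/
def residual (Q : Measure Ω) (f : Ω → ι → ℝ) (z : Ω → τ → ℝ) (ω : Ω) : ι → ℝ :=
  f ω - (secondMoment Q f z * (secondMoment Q z z)⁻¹) *ᵥ z ω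

/-- The partial covariance of `f` and `g` given `z`: the second moment of their residuals. -/
def partialCov (Q : Measure Ω) (f : Ω → ι → ℝ) (g : Ω → κ → ℝ) (z : Ω → τ → ℝ) : Matrix ι κ ℝ :=
  secondMoment Q (residual Q f z) (residual Q g z)

theorem partialCov_transpose (Q : Measure Ω) (f : Ω → ι → ℝ) (g : Ω → κ → ℝ) (z : Ω → τ → ℝ) :
    (partialCov Q f g z)ᵀ = partialCov Q g f z :=
  secondMoment_transpose Q _ _

theorem residual_congr {f f' : Ω → ι → ℝ} {z : Ω → τ → ℝ} (h : f =ᵐ[Q] f') :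
    residual Q f z =ᵐ[Q] residual Q f' z := by
  filter_upwards [h] with ω hω
  rw [residual, residual, hω, secondMoment_congr h .rfl]

theorem partialCov_congr {f f' : Ω → ι → ℝ} {g g' : Ω → κ → ℝ} {z : Ω → τ → ℝ} (hf : f =ᵐ[Q] f')
    (hg : g =ᵐ[Q] g') : partialCov Q f g z = partialCov Q f' g' z :=
  secondMoment_congr (residual_congr hf) (residual_congr hg)

variable [Fintype ι] [Fintype κ]
variable {f : Ω → ι → ℝ} {g : Ω → κ → ℝ} {z : Ω → τ → ℝ}

theorem memLp_residual (hf : MemLp f 2 Q) (hz : MemLp z 2 Q) : MemLp (residual Q f z) 2 Q :=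
  hf.sub (memLp_mulVec _ hz)

theorem secondMoment_residual_self (hf : MemLp f 2 Q) (hz : MemLp z 2 Q)
    (hdet : IsUnit (secondMoment Q z z).det) : secondMoment Q (residual Q f z) z = 0 := by
  unfold residual
  rw [secondMoment_sub_left hf (memLp_mulVec _ hz) hz, secondMoment_mulVec_left _ hz hz,
    Matrix.mul_assoc, nonsing_inv_mul _ hdet, Matrix.mul_one, sub_self]

theorem residual_eq_sub_mulVec_of_secondMoment_eq_zero {A : Matrix ι τ ℝ} (hf : MemLp f 2 Q)
    (hz : MemLp z 2 Q) (hdet : IsUnit (secondMoment Q z z).det)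
    (h : secondMoment Q (fun ω => f ω - A *ᵥ z ω) z = 0) :
    residual Q f z = fun ω => f ω - A *ᵥ z ω := by
  rw [secondMoment_sub_left hf (memLp_mulVec _ hz) hz, secondMoment_mulVec_left _ hz hz,
    sub_eq_zero] at h
  funext ω
  rw [residual, h, Matrix.mul_assoc, mul_nonsing_inv _ hdet, Matrix.mul_one]

theorem residual_mulVec (A : Matrix σ ι ℝ) (hf : MemLp f 2 Q) (hz : MemLp z 2 Q) :
    residual Q (fun ω => A *ᵥ f ω) z = fun ω => A *ᵥ residual Q f z ω := by
  funext ω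
  simp only [residual]
  rw [secondMoment_mulVec_left A hf hz, mulVec_sub, mulVec_mulVec, Matrix.mul_assoc]

theorem partialCov_mulVec_left (A : Matrix σ ι ℝ) (hf : MemLp f 2 Q) (hg : MemLp g 2 Q)
    (hz : MemLp z 2 Q) : partialCov Q (fun ω => A *ᵥ f ω) g z = A * partialCov Q f g z := by
  rw [partialCov, residual_mulVec A hf hz,
    secondMoment_mulVec_left A (memLp_residual hf hz) (memLp_residual hg hz), partialCov]

theorem partialCov_mulVec_right (A : Matrix σ κ ℝ) (hf : MemLp f 2 Q) (hg : MemLp g 2 Q)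
    (hz : MemLp z 2 Q) : partialCov Q f (fun ω => A *ᵥ g ω) z = partialCov Q f g z * Aᵀ := by
  rw [← partialCov_transpose, partialCov_mulVec_left A hg hf hz, transpose_mul,
    partialCov_transpose]

theorem secondMoment_residual_right_eq_partialCov (hf : MemLp f 2 Q) (hg : MemLp g 2 Q)
    (hz : MemLp z 2 Q) (hdet : IsUnit (secondMoment Q z z).det) :
    secondMoment Q (residual Q f z) g = partialCov Q f g z := by
  have hgz : residual Q g z = fun ω => g ω -
    (secondMoment Q g z * (secondMoment Q z z)⁻¹) *ᵥ z ω := rfl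
  rw [partialCov, hgz, secondMoment_sub_right (memLp_residual hf hz) hg (memLp_mulVec _ hz),
    secondMoment_mulVec_right _ hz (memLp_residual hf hz), secondMoment_residual_self hf hz hdet,
    Matrix.zero_mul, sub_zero]

theorem partialCov_eq_schurComplement (hf : MemLp f 2 Q) (hg : MemLp g 2 Q) (hz : MemLp z 2 Q)
    (hdet : IsUnit (secondMoment Q z z).det) :
    partialCov Q f g z = secondMoment Q f g -
      secondMoment Q f z * (secondMoment Q z z)⁻¹ * (secondMoment Q g z)ᵀ := by
  rw [← secondMoment_residual_right_eq_partialCov hf hg hz hdet]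
  unfold residual
  rw [secondMoment_sub_left hf (memLp_mulVec _ hz) hg, secondMoment_mulVec_left _ hz hg,
    secondMoment_transpose]

theorem residual_comp_measurePreserving {π : Ω → Ω'} (hπ : MeasurePreserving π Q P)
    {f : Ω' → ι → ℝ} {z : Ω' → τ → ℝ} (hf : MemLp f 2 P) (hz : MemLp z 2 P) :
    residual Q (f ∘ π) (z ∘ π) = residual P f z ∘ π := by
  funext ω
  simp only [residual, Function.comp_apply, secondMoment_comp_measurePreserving hπ hf hz,
    secondMoment_comp_measurePreserving hπ hz hz]

theorem partialCov_comp_measurePreserving {π : Ω → Ω'} (hπ : MeasurePreserving π Q P)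
    {f : Ω' → ι → ℝ} {g : Ω' → κ → ℝ} {z : Ω' → τ → ℝ} (hf : MemLp f 2 P) (hg : MemLp g 2 P)
    (hz : MemLp z 2 P) : partialCov Q (f ∘ π) (g ∘ π) (z ∘ π) = partialCov P f g z := by
  rw [partialCov, residual_comp_measurePreserving hπ hf hz,
    residual_comp_measurePreserving hπ hg hz,
    secondMoment_comp_measurePreserving hπ (memLp_residual hf hz) (memLp_residual hg hz),
    partialCov]

theorem integral_residual (hf : MemLp f 2 Q) (hz : MemLp z 2 Q) [IsFiniteMeasure Q]
    (hf0 : ∫ ω, f ω ∂Q = 0) (hz0 : ∫ ω, z ω ∂Q = 0) : ∫ ω, residual Q f z ω ∂Q = 0 := by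
  unfold residual
  rw [integral_sub (hf.integrable one_le_two) ((memLp_mulVec _ hz).integrable one_le_two), hf0,
    integral_mulVec _ (hz.integrable one_le_two), hz0, mulVec_zero, sub_zero]

theorem fromBlocks_partialCov_posSemidef (hf : MemLp f 2 Q) (hg : MemLp g 2 Q) (hz : MemLp z 2 Q) :
    (fromBlocks (partialCov Q f f z) (partialCov Q f g z) (partialCov Q f g z)ᵀ
      (partialCov Q g g z)).PosSemidef := by
  convert! posSemidef_secondMoment_self (memLp_sumElim (memLp_residual hf hz)
    (memLp_residual hg hz))
  rw [partialCov_transpose]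
  ext (i | i) (j | j) <;> rfl

section Stacked

variable [Fintype σ] [DecidableEq σ] {y : Ω → σ → ℝ}

theorem det_secondMoment_sumElim (hy : MemLp y 2 Q) (hz : MemLp z 2 Q)
    (hdet : IsUnit (secondMoment Q z z).det) :
    (secondMoment Q (fun ω => Sum.elim (y ω) (z ω)) (fun ω => Sum.elim (y ω) (z ω))).det =
      (secondMoment Q z z).det * (partialCov Q y y z).det := by
  have : Invertible (secondMoment Q z z) := invertibleOfIsUnitDet _ hdet
  rw [secondMoment_sumElim, det_fromBlocks₂₂, invOf_eq_nonsing_inv,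
    partialCov_eq_schurComplement hy hy hz hdet, secondMoment_transpose]

/-- The Frisch–Waugh–Lovell theorem. -/
theorem residual_sumElim (hf : MemLp f 2 Q) (hy : MemLp y 2 Q) (hz : MemLp z 2 Q)
    (hdet : IsUnit (secondMoment Q z z).det) (hs : IsUnit (partialCov Q y y z).det) :
    residual Q f (fun ω => Sum.elim (y ω) (z ω)) =
      residual Q (residual Q f z) (residual Q y z) := by
  have hyz := memLp_sumElim hy hz
  have hry := memLp_residual hy hz
  have hrf := memLp_residual hf hz
  set B := partialCov Q f y z * (partialCov Q y y z)⁻¹ with hB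
  set A : Matrix ι (σ ⊕ τ) ℝ := fromCols B (secondMoment Q f z * (secondMoment Q z z)⁻¹ -
    B * (secondMoment Q y z * (secondMoment Q z z)⁻¹)) with hA
  have heq : (fun ω => f ω - A *ᵥ Sum.elim (y ω) (z ω)) =
      fun ω => residual Q f z ω - B *ᵥ residual Q y z ω := by
    funext ω
    rw [hA, fromCols_mulVec_sumElim, sub_mulVec, residual, residual, mulVec_sub, mulVec_mulVec]
    abel
  have hy0 : secondMoment Q (fun ω => residual Q f z ω - B *ᵥ residual Q y z ω) y = 0 := by
    rw [secondMoment_sub_left hrf (memLp_mulVec _ hry) hy, secondMoment_mulVec_left _ hry hy,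
      secondMoment_residual_right_eq_partialCov hf hy hz hdet,
      secondMoment_residual_right_eq_partialCov hy hy hz hdet, hB, Matrix.mul_assoc,
      nonsing_inv_mul _ hs, Matrix.mul_one, sub_self]
  have hz0 : secondMoment Q (fun ω => residual Q f z ω - B *ᵥ residual Q y z ω) z = 0 := by
    rw [secondMoment_sub_left hrf (memLp_mulVec _ hry) hz, secondMoment_mulVec_left _ hry hz,
      secondMoment_residual_self hf hz hdet, secondMoment_residual_self hy hz hdet,
      Matrix.mul_zero, sub_self]
  have hunit : IsUnit (secondMoment Q (fun ω => Sum.elim (y ω) (z ω))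
      (fun ω => Sum.elim (y ω) (z ω))).det := by
    rw [det_secondMoment_sumElim hy hz hdet]
    exact hdet.mul hs
  rw [residual_eq_sub_mulVec_of_secondMoment_eq_zero (A := A) hf hyz hunit, heq]
  · rfl
  · rw [heq]
    ext i (j | j)
    exacts [congrFun₂ hy0 i j, congrFun₂ hz0 i j]

theorem partialCov_sumElim (hf : MemLp f 2 Q) (hg : MemLp g 2 Q) (hy : MemLp y 2 Q)
    (hz : MemLp z 2 Q) (hdet : IsUnit (secondMoment Q z z).det)
    (hs : IsUnit (partialCov Q y y z).det) :
    partialCov Q f g (fun ω => Sum.elim (y ω) (z ω)) =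
      partialCov Q f g z - partialCov Q f y z * (partialCov Q y y z)⁻¹ * (partialCov Q g y z)ᵀ := by
  rw [partialCov, residual_sumElim hf hy hz hdet hs, residual_sumElim hg hy hz hdet hs]
  exact partialCov_eq_schurComplement (memLp_residual hf hz) (memLp_residual hg hz)
    (memLp_residual hy hz) hs

end Stacked

end Residual

/-! ### Optimality of the linear estimator -/

section Optimality

variable {Ω B E : Type*} [MeasurableSpace Ω] [MeasurableSpace B] {Q : Measure Ω}
variable [NormedAddCommGroup E] [InnerProductSpace ℝ E] [CompleteSpace E]

theorem lintegral_enorm_sq_le_lintegral_enorm_add_const_sq [IsFiniteMeasure Q] {u : Ω → E}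
    (hu : MemLp u 2 Q) (hu0 : ∫ ω, u ω ∂Q = 0) (c : E) :
    ∫⁻ ω, ‖u ω‖ₑ ^ 2 ∂Q ≤ ∫⁻ ω, ‖u ω + c‖ₑ ^ 2 ∂Q := by
  have hc : MemLp (fun _ => c) 2 Q := memLp_const c
  have hinner : Integrable (fun ω => 2 * inner ℝ c (u ω)) Q :=
    ((hu.integrable one_le_two).const_inner c).const_mul 2
  have hadd : Integrable (fun ω => ‖u ω‖ ^ 2 + 2 * inner ℝ c (u ω)) Q :=
    hu.norm.integrable_sq.add hinner
  have hexpand : ∀ ω, ‖u ω + c‖ ^ 2 = ‖u ω‖ ^ 2 + 2 * inner ℝ c (u ω) + ‖c‖ ^ 2 := fun ω => by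
    rw [norm_add_sq_real, real_inner_comm]
  rw [lintegral_enorm_sq_eq_ofReal_integral hu,
    lintegral_enorm_sq_eq_ofReal_integral (u := fun ω => u ω + c) (hu.add hc)]
  refine ENNReal.ofReal_le_ofReal ?_
  simp_rw [hexpand]
  rw [integral_add hadd (integrable_const _), integral_add hu.norm.integrable_sq hinner,
    integral_const_mul, integral_inner (hu.integrable one_le_two), hu0, inner_zero_right, mul_zero,
    add_zero]
  exact le_add_of_nonneg_right (integral_nonneg fun _ => sq_nonneg _)

variable [IsProbabilityMeasure Q] [MeasurableSpace E] [BorelSpace E] [SecondCountableTopology E]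

/-- Given `q` and the draw `v`, the estimation error is the centred vector `u` shifted by the
constant `m q - v`, and a shift can only increase its second moment. -/
theorem lintegral_enorm_sq_le_of_indepFun {u : Ω → E} {q : Ω → B} (hq : AEMeasurable q Q)
    (hind : IndepFun u q Q) (hu : MemLp u 2 Q) (hu0 : ∫ ω, u ω ∂Q = 0) {m : B → E}
    (hm : Measurable m) (e : Kernel B E) [IsMarkovKernel e] :
    ∫⁻ ω, ‖u ω‖ₑ ^ 2 ∂Q ≤ ∫⁻ ω, ∫⁻ v, ‖u ω + m (q ω) - v‖ₑ ^ 2 ∂(e (q ω)) ∂Q := by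
  have hum : AEMeasurable u Q := hu.aestronglyMeasurable.aemeasurable
  have : IsProbabilityMeasure (Q.map u) := Measure.isProbabilityMeasure_map hum
  have : IsProbabilityMeasure (Q.map q) := Measure.isProbabilityMeasure_map hq
  have hF : Measurable fun p : B × E => ∫⁻ v, ‖p.2 + m p.1 - v‖ₑ ^ 2 ∂(e p.1) :=
    Measurable.lintegral_kernel_prod_right (κ := e.comap Prod.fst measurable_fst)
      (f := fun (p : B × E) v => ‖p.2 + m p.1 - v‖ₑ ^ 2) (by fun_prop)
  have hmap : Q.map (fun ω => (q ω, u ω)) = (Q.map q).prod (Q.map u) :=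
    (indepFun_iff_map_prod_eq_prod_map_map hq hum).1 hind.symm
  calc ∫⁻ ω, ‖u ω‖ₑ ^ 2 ∂Q
      = ∫⁻ b, ∫⁻ _, ∫⁻ ω, ‖u ω‖ₑ ^ 2 ∂Q ∂(e b) ∂(Q.map q) := by
        simp only [lintegral_const, measure_univ, mul_one]
    _ ≤ ∫⁻ b, ∫⁻ v, ∫⁻ ω, ‖u ω + (m b - v)‖ₑ ^ 2 ∂Q ∂(e b) ∂(Q.map q) :=
        lintegral_mono fun b => lintegral_mono fun v =>
          lintegral_enorm_sq_le_lintegral_enorm_add_const_sq hu hu0 _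
    _ = ∫⁻ b, ∫⁻ v, ∫⁻ a, ‖a + m b - v‖ₑ ^ 2 ∂(Q.map u) ∂(e b) ∂(Q.map q) := by
        congr 1 with b
        congr 1 with v
        rw [lintegral_map' (by fun_prop) hum]
        simp only [add_sub_assoc]
    _ = ∫⁻ b, ∫⁻ a, ∫⁻ v, ‖a + m b - v‖ₑ ^ 2 ∂(e b) ∂(Q.map u) ∂(Q.map q) := by
        congr 1 with b
        rw [lintegral_lintegral_swap (by fun_prop)]
    _ = ∫⁻ p, ∫⁻ v, ‖p.2 + m p.1 - v‖ₑ ^ 2 ∂(e p.1) ∂((Q.map q).prod (Q.map u)) := by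
        rw [lintegral_prod _ hF.aemeasurable]
    _ = ∫⁻ ω, ∫⁻ v, ‖u ω + m (q ω) - v‖ₑ ^ 2 ∂(e (q ω)) ∂Q := by
        rw [← hmap, lintegral_map' hF.aemeasurable (hq.prodMk hum)]

end Optimality

section Gaussian

section MeasurePreserving

variable {Ω Ω' : Type*} [MeasurableSpace Ω] [MeasurableSpace Ω'] {Q : Measure Ω} {P : Measure Ω'}
  {E : Type*} [NormedAddCommGroup E] [NormedSpace ℝ E] {π : Ω → Ω'} {T : Ω' → E}

theorem hasGaussianLaw_comp_measurePreserving [MeasurableSpace E] (hT : HasGaussianLaw T P)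
    (hπ : MeasurePreserving π Q P) : HasGaussianLaw (T ∘ π) Q := by
  have hTm : AEMeasurable T (Q.map π) := hπ.map_eq ▸ hT.aemeasurable
  exact ⟨by
    rw [← AEMeasurable.map_map_of_aemeasurable hTm hπ.aemeasurable, hπ.map_eq]
    exact hT.isGaussian_map⟩

theorem integral_comp_measurePreserving (hT : AEStronglyMeasurable T P)
    (hπ : MeasurePreserving π Q P) : ∫ ω, T (π ω) ∂Q = ∫ ω, T ω ∂P := by
  have hTm : AEStronglyMeasurable T (Q.map π) := hπ.map_eq ▸ hT
  rw [← integral_map hπ.aemeasurable hTm, hπ.map_eq]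

end MeasurePreserving

variable {Ω : Type*} [MeasurableSpace Ω] {Q : Measure Ω} [IsProbabilityMeasure Q]
variable {ι τ : Type*} [Finite ι] [Fintype τ] [DecidableEq τ]

theorem indepFun_residual {f : Ω → ι → ℝ} {z : Ω → τ → ℝ}
    (hfz : HasGaussianLaw (fun ω => (f ω, z ω)) Q) (hz0 : ∫ ω, z ω ∂Q = 0)
    (hdet : IsUnit (secondMoment Q z z).det) : IndepFun (residual Q f z) z Q := by
  have := Fintype.ofFinite ι
  have hf2 : MemLp f 2 Q := hfz.fst.memLp_two
  have hz2 : MemLp z 2 Q := hfz.snd.memLp_two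
  have hres : HasGaussianLaw (fun ω => (residual Q f z ω, z ω)) Q :=
    hfz.map_fun (LinearMap.toContinuousLinearMap ((LinearMap.fst ℝ (ι → ℝ) (τ → ℝ) -
      (secondMoment Q f z * (secondMoment Q z z)⁻¹).mulVecLin ∘ₗ LinearMap.snd ℝ _ _).prod
        (LinearMap.snd ℝ _ _)))
  refine hres.indepFun_of_covariance_eval fun i j => ?_
  have hzj0 : ∫ ω, z ω j ∂Q = 0 := by
    rw [← eval_integral fun j => (hz2.eval j).integrable one_le_two, hz0, Pi.zero_apply]
  rw [covariance_eq_sub ((memLp_residual hf2 hz2).eval i) (hz2.eval j), hzj0, mul_zero, sub_zero]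
  exact congrFun₂ (secondMoment_residual_self hf2 hz2 hdet) i j

end Gaussian

/-! ### The joint law of the sample point and the message -/

section JointLaw

variable {Ω I Y : Type*} [MeasurableSpace Ω] [MeasurableSpace I] [MeasurableSpace Y]
variable {P : Measure Ω} {o : Ω → I}

instance (γ : Policy I Y) : IsMarkovKernel γ.1 := γ.2

/-- The law of the pair `(ω, y)` of the sample point and the message `y ~ γ (· | o ω)`. -/
def jointLaw (P : Measure Ω) (ho : Measurable o) (γ : Policy I Y) : Measure (Ω × Y) :=
  P ⊗ₘ γ.1.comap o ho

instance [IsProbabilityMeasure P] (ho : Measurable o) (γ : Policy I Y) :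
    IsProbabilityMeasure (jointLaw P ho γ) :=
  inferInstanceAs (IsProbabilityMeasure (P ⊗ₘ γ.1.comap o ho))

theorem snd_ae_eq_jointLaw [MeasurableEq Y] (ho : Measurable o) {γ : Policy I Y}
    {g : Ω → Y} (hg : Measurable g) (h : ∀ᵐ ω ∂P, ∀ᵐ y ∂(γ.1 (o ω)), y = g ω) :
    ∀ᵐ q ∂(jointLaw P ho γ), q.2 = g q.1 :=
  Measure.ae_compProd_of_ae_ae (measurableSet_eq_fun measurable_snd (hg.comp measurable_fst)) h

variable [IsProbabilityMeasure P]

theorem measurePreserving_fst_jointLaw (ho : Measurable o) (γ : Policy I Y) :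
    MeasurePreserving Prod.fst (jointLaw P ho γ) P :=
  ⟨measurable_fst, Measure.fst_compProd P _⟩

theorem lintegral_jointLaw (ho : Measurable o) {γ : Policy I Y} {f : Ω × Y → ℝ≥0∞}
    (hf : AEMeasurable f (jointLaw P ho γ)) :
    ∫⁻ q, f q ∂(jointLaw P ho γ) = ∫⁻ ω, ∫⁻ y, f (ω, y) ∂(γ.1 (o ω)) ∂P := by
  rw [jointLaw, Measure.compProd] at hf ⊢
  rw [Kernel.lintegral_compProd₀ _ _ _ hf]
  simp

theorem integral_jointLaw (ho : Measurable o) {γ : Policy I ℝ} {f : Ω × ℝ → ℝ}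
    (hf : Integrable f (jointLaw P ho γ)) :
    ∫ q, f q ∂(jointLaw P ho γ) = msgExpect P o γ fun ω y => f (ω, y) :=
  Measure.integral_compProd hf

end JointLaw

section Message

variable {Ω I : Type*} [MeasurableSpace Ω] [MeasurableSpace I] {P : Measure Ω}
  [IsProbabilityMeasure P] {o : Ω → I} {γ : Policy I ℝ} {n nz : ℕ} {v : Ω → Vec n} {z : Ω → Vec nz}

/-- The scalar message, as a one-dimensional random vector under `jointLaw`. -/
def message (q : Ω × ℝ) (_ : Unit) : ℝ := q.2

/-- The pair `(y, z)` available to the receiver and the malicious agent, as a random vector under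
`jointLaw`. -/
def observation (z : Ω → Vec nz) (q : Ω × ℝ) : Unit ⊕ Fin nz → ℝ := stackYZ q.2 (z q.1)

theorem memLp_message_iff (ho : Measurable o) :
    MemLp message 2 (jointLaw P ho γ) ↔ ∫⁻ ω, ∫⁻ y, ‖y‖ₑ ^ 2 ∂(γ.1 (o ω)) ∂P ≠ ∞ := by
  have hfin : MemLp Prod.snd 2 (jointLaw P ho γ) ↔ ∫⁻ ω, ∫⁻ y, ‖y‖ₑ ^ 2 ∂(γ.1 (o ω)) ∂P ≠ ∞ := by
    rw [MemLp, and_iff_right measurable_snd.aestronglyMeasurable,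
      eLpNorm_lt_top_iff_lintegral_rpow_enorm_lt_top two_ne_zero ENNReal.ofNat_ne_top,
      lintegral_jointLaw ho (by fun_prop), lt_top_iff_ne_top]
    simp only [ENNReal.toReal_ofNat, ENNReal.rpow_ofNat]
  rw [← hfin, memLp_pi_iff]
  exact ⟨fun h => h (), fun h _ => h⟩

theorem memLp_ofLp {Q : Measure Ω} (hv : MemLp v 2 Q) : MemLp (fun ω => (v ω).ofLp) 2 Q :=
  (PiLp.continuousLinearEquiv 2 ℝ fun _ : Fin n => ℝ).toContinuousLinearMap.comp_memLp' hv

theorem memLp_observation (ho : Measurable o) (hy : MemLp message 2 (jointLaw P ho γ))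
    (hz : MemLp z 2 P) : MemLp (observation z) 2 (jointLaw P ho γ) :=
  memLp_sumElim hy ((memLp_ofLp hz).comp_measurePreserving (measurePreserving_fst_jointLaw ho γ))

theorem obsMoment_eq_secondMoment (ho : Measurable o) (hy : MemLp message 2 (jointLaw P ho γ))
    (hz : MemLp z 2 P) :
    obsMoment P z o γ = secondMoment (jointLaw P ho γ) (observation z) (observation z) := by
  have hobs := memLp_observation ho hy hz
  ext i j
  exact (integral_jointLaw ho (integrable_eval_mul_eval hobs hobs i j)).symm

theorem crossMoment_eq_secondMoment (ho : Measurable o) (hy : MemLp message 2 (jointLaw P ho γ))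
    (hv : MemLp v 2 P) (hz : MemLp z 2 P) :
    crossMoment P v z o γ =
      secondMoment (jointLaw P ho γ) ((fun ω => (v ω).ofLp) ∘ Prod.fst) (observation z) := by
  have hv' := (memLp_ofLp hv).comp_measurePreserving (measurePreserving_fst_jointLaw ho γ)
  ext i j
  exact (integral_jointLaw ho
    (integrable_eval_mul_eval hv' (memLp_observation ho hy hz) i j)).symm

theorem isRegular_iff (ho : Measurable o) (hz : MemLp z 2 P)
    (hdet : IsUnit (secondMoment P (fun ω => (z ω).ofLp) (fun ω => (z ω).ofLp)).det) :
    IsRegular P z o γ ↔ MemLp message 2 (jointLaw P ho γ) ∧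
      IsUnit (partialCov (jointLaw P ho γ) message message
        ((fun ω => (z ω).ofLp) ∘ Prod.fst)).det := by
  have hπ := measurePreserving_fst_jointLaw (P := P) ho γ
  have hz' := memLp_ofLp hz
  rw [IsRegular, ← memLp_message_iff ho]
  refine and_congr_right fun hy => ?_
  have hdet' : IsUnit (secondMoment (jointLaw P ho γ) ((fun ω => (z ω).ofLp) ∘ Prod.fst)
      ((fun ω => (z ω).ofLp) ∘ Prod.fst)).det := by
    rwa [secondMoment_comp_measurePreserving hπ hz' hz']
  rw [obsMoment_eq_secondMoment ho hy hz,
    show (secondMoment (jointLaw P ho γ) (observation z) (observation z)).det = _ from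
      det_secondMoment_sumElim hy (hz'.comp_measurePreserving hπ) hdet',
    IsUnit.mul_iff]
  exact and_iff_right hdet'

end Message

section Estimation

variable {Ω I : Type*} [MeasurableSpace Ω] [MeasurableSpace I] {P : Measure Ω} {o : Ω → I}
  {γ : Policy I ℝ} {n nz : ℕ} {v : Ω → Vec n} {z : Ω → Vec nz}

theorem measurable_lmmse (P : Measure Ω) (v : Ω → Vec n) (z : Ω → Vec nz) (o : Ω → I)
    (γ : Policy I ℝ) : Measurable (lmmse P v z o γ) := by
  have hstack : Measurable fun q : ℝ × Vec nz => stackYZ q.1 q.2 :=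
    measurable_pi_lambda _ <| Sum.rec (fun _ => measurable_fst) fun j =>
      (measurable_pi_apply j).comp ((WithLp.measurable_ofLp 2 _).comp measurable_snd)
  have hlin : ∀ {κ : Type} [Fintype κ] (A : Matrix (Fin n) κ ℝ),
      Measurable fun u : κ → ℝ => WithLp.toLp 2 (A *ᵥ u) := fun A =>
    (WithLp.measurable_toLp 2 _).comp
      (LinearMap.toContinuousLinearMap (mulVecLin A)).measurable
  unfold lmmse
  split_ifs
  · exact (hlin _).comp hstack
  · exact (hlin _).comp ((WithLp.measurable_ofLp 2 _).comp measurable_snd)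

/-- The policy that reports the linear minimum mean square error estimate. -/
def lmmsePolicy (P : Measure Ω) (v : Ω → Vec n) (z : Ω → Vec nz) (o : Ω → I)
    (γ : Policy I ℝ) : Policy (ℝ × Vec nz) (Vec n) :=
  ⟨Kernel.deterministic (lmmse P v z o γ) (measurable_lmmse P v z o γ), inferInstance⟩

theorem lmmsePolicy_apply (P : Measure Ω) (v : Ω → Vec n) (z : Ω → Vec nz) (o : Ω → I)
    (γ : Policy I ℝ) (q : ℝ × Vec nz) :
    (lmmsePolicy P v z o γ).1 q = Measure.dirac (lmmse P v z o γ q) :=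
  Kernel.deterministic_apply (measurable_lmmse P v z o γ) _

theorem ae_lmmsePolicy_eq (P : Measure Ω) (v : Ω → Vec n) (z : Ω → Vec nz) (o : Ω → I)
    (γ : Policy I ℝ) (q : ℝ × Vec nz) :
    ∀ᵐ vh ∂((lmmsePolicy P v z o γ).1 q), vh = lmmse P v z o γ q := by
  rw [lmmsePolicy_apply, ae_dirac_eq]
  rfl

open Classical in
/-- The second moment of the error made by the linear minimum mean square error estimator of `v`. -/
def errorMoment {ι : Type*} (P : Measure Ω) (v : Ω → ι → ℝ) (z : Ω → Vec nz) (ho : Measurable o)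
    (γ : Policy I ℝ) : Matrix ι ι ℝ :=
  if IsRegular P z o γ then
    partialCov (jointLaw P ho γ) (v ∘ Prod.fst) (v ∘ Prod.fst) (observation z)
  else partialCov P v v fun ω => (z ω).ofLp

theorem ofLp_sub_lmmse_of_not_isRegular (hreg : ¬ IsRegular P z o γ) (q : Ω × ℝ) :
    (v q.1 - lmmse P v z o γ (q.2, z q.1)).ofLp =
      residual P (fun ω => (v ω).ofLp) (fun ω => (z ω).ofLp) q.1 := by
  rw [lmmse, if_neg hreg]
  rfl

variable [IsProbabilityMeasure P]

theorem estError_eq_lintegral_jointLaw (ho : Measurable o) (hv : AEMeasurable v P)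
    (hz : AEMeasurable z P) (e : Policy (ℝ × Vec nz) (Vec n)) :
    estError P v z o γ e =
      ∫⁻ q, ∫⁻ vh, ‖v q.1 - vh‖ₑ ^ 2 ∂(e.1 (q.2, z q.1)) ∂(jointLaw P ho γ) := by
  have hπ := (measurePreserving_fst_jointLaw (P := P) ho γ).quasiMeasurePreserving
  have hF : Measurable fun p : Vec n × ℝ × Vec nz => ∫⁻ vh, ‖p.1 - vh‖ₑ ^ 2 ∂(e.1 p.2) :=
    Measurable.lintegral_kernel_prod_right (κ := e.1.comap Prod.snd measurable_snd)
      (f := fun (p : Vec n × ℝ × Vec nz) vh => ‖p.1 - vh‖ₑ ^ 2) (by fun_prop)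
  exact (lintegral_jointLaw ho (hF.comp_aemeasurable ((hv.comp_quasiMeasurePreserving hπ).prodMk
    (measurable_snd.aemeasurable.prodMk (hz.comp_quasiMeasurePreserving hπ))))).symm

theorem estError_lmmsePolicy_eq_lintegral_jointLaw (ho : Measurable o) (hv : AEMeasurable v P)
    (hz : AEMeasurable z P) :
    estError P v z o γ (lmmsePolicy P v z o γ) =
      ∫⁻ q, ‖v q.1 - lmmse P v z o γ (q.2, z q.1)‖ₑ ^ 2 ∂(jointLaw P ho γ) := by
  rw [estError_eq_lintegral_jointLaw ho hv hz]
  simp_rw [lmmsePolicy_apply]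
  refine lintegral_congr fun q => lintegral_dirac' _ (by fun_prop)

theorem ofLp_sub_lmmse_of_isRegular (ho : Measurable o) (hv : MemLp v 2 P) (hz : MemLp z 2 P)
    (hreg : IsRegular P z o γ) (q : Ω × ℝ) :
    (v q.1 - lmmse P v z o γ (q.2, z q.1)).ofLp =
      residual (jointLaw P ho γ) ((fun ω => (v ω).ofLp) ∘ Prod.fst) (observation z) q := by
  have hy := (memLp_message_iff ho).2 hreg.1
  rw [lmmse, if_pos hreg, obsMoment_eq_secondMoment ho hy hz,
    crossMoment_eq_secondMoment ho hy hv hz]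
  rfl

theorem memLp_sub_lmmse (ho : Measurable o) (hv : MemLp v 2 P) (hz : MemLp z 2 P) :
    MemLp (fun q : Ω × ℝ => v q.1 - lmmse P v z o γ (q.2, z q.1)) 2 (jointLaw P ho γ) := by
  have hπ := measurePreserving_fst_jointLaw (P := P) ho γ
  suffices h : MemLp (fun q : Ω × ℝ => (v q.1 - lmmse P v z o γ (q.2, z q.1)).ofLp) 2
      (jointLaw P ho γ) from
    (PiLp.continuousLinearEquiv 2 ℝ fun _ : Fin n => ℝ).symm.toContinuousLinearMap.comp_memLp' h
  by_cases hreg : IsRegular P z o γ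
  · simp_rw [ofLp_sub_lmmse_of_isRegular ho hv hz hreg]
    exact memLp_residual ((memLp_ofLp hv).comp_measurePreserving hπ)
      (memLp_observation ho ((memLp_message_iff ho).2 hreg.1) hz)
  · simp_rw [ofLp_sub_lmmse_of_not_isRegular hreg]
    exact (memLp_residual (memLp_ofLp hv) (memLp_ofLp hz)).comp_measurePreserving hπ

theorem estError_lmmsePolicy (ho : Measurable o) (hv : MemLp v 2 P) (hz : MemLp z 2 P) :
    estError P v z o γ (lmmsePolicy P v z o γ) =
      ENNReal.ofReal (errorMoment P (fun ω => (v ω).ofLp) z ho γ).trace := by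
  rw [estError_lmmsePolicy_eq_lintegral_jointLaw ho hv.aestronglyMeasurable.aemeasurable
    hz.aestronglyMeasurable.aemeasurable,
    lintegral_enorm_sq_eq_trace_secondMoment (memLp_sub_lmmse ho hv hz)]
  by_cases hreg : IsRegular P z o γ
  · simp_rw [ofLp_sub_lmmse_of_isRegular ho hv hz hreg]
    rw [errorMoment, if_pos hreg]
    rfl
  · have hres := memLp_residual (memLp_ofLp hv) (memLp_ofLp hz)
    simp_rw [ofLp_sub_lmmse_of_not_isRegular hreg]
    rw [errorMoment, if_neg hreg, partialCov,
      ← secondMoment_comp_measurePreserving (measurePreserving_fst_jointLaw ho γ) hres hres]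
    rfl

theorem posSemidef_errorMoment {ι : Type*} [Fintype ι] {f : Ω → ι → ℝ} (ho : Measurable o)
    (hf : MemLp f 2 P) (hz : MemLp z 2 P) : (errorMoment P f z ho γ).PosSemidef := by
  unfold errorMoment
  split_ifs with hreg
  · exact posSemidef_secondMoment_self (memLp_residual
      (hf.comp_measurePreserving (measurePreserving_fst_jointLaw ho γ))
      (memLp_observation ho ((memLp_message_iff ho).2 hreg.1) hz))
  · exact posSemidef_secondMoment_self (memLp_residual hf (memLp_ofLp hz))

theorem integral_sub_lmmse_of_isRegular (ho : Measurable o) (hv : MemLp v 2 P) (hz : MemLp z 2 P)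
    (hreg : IsRegular P z o γ) (hv0 : ∫ q, (v q.1).ofLp ∂(jointLaw P ho γ) = 0)
    (hobs0 : ∫ q, observation z q ∂(jointLaw P ho γ) = 0) :
    ∫ q, (v q.1 - lmmse P v z o γ (q.2, z q.1)) ∂(jointLaw P ho γ) = 0 := by
  have hπ := measurePreserving_fst_jointLaw (P := P) ho γ
  have hres := integral_residual ((memLp_ofLp hv).comp_measurePreserving hπ)
    (memLp_observation ho ((memLp_message_iff ho).2 hreg.1) hz) hv0 hobs0
  simp_rw [← ofLp_sub_lmmse_of_isRegular ho hv hz hreg] at hres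
  have hcomm := (PiLp.continuousLinearEquiv 2 ℝ fun _ : Fin n => ℝ).integral_comp_comm
    (μ := jointLaw P ho γ) fun q => v q.1 - lmmse P v z o γ (q.2, z q.1)
  exact (PiLp.continuousLinearEquiv 2 ℝ fun _ : Fin n => ℝ).map_eq_zero_iff.1
    (hcomm.symm.trans hres)

theorem indepFun_sub_lmmse_of_isRegular (ho : Measurable o) (hv : MemLp v 2 P) (hz : MemLp z 2 P)
    (hreg : IsRegular P z o γ)
    (hgauss : HasGaussianLaw (fun q => ((v q.1).ofLp, observation z q)) (jointLaw P ho γ))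
    (hobs0 : ∫ q, observation z q ∂(jointLaw P ho γ) = 0) :
    IndepFun (fun q : Ω × ℝ => v q.1 - lmmse P v z o γ (q.2, z q.1))
      (fun q => (q.2, z q.1)) (jointLaw P ho γ) := by
  have hdet := hreg.2
  rw [obsMoment_eq_secondMoment ho ((memLp_message_iff ho).2 hreg.1) hz] at hdet
  have hind := indepFun_residual hgauss hobs0 hdet
  have hsplit : Measurable fun b : Unit ⊕ Fin nz → ℝ =>
      (b (Sum.inl ()), (WithLp.toLp 2 fun j => b (Sum.inr j) : Vec nz)) := by fun_prop
  convert! hind.comp (WithLp.measurable_toLp 2 _) hsplit using 1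
  funext q
  exact congrArg (WithLp.toLp 2) (ofLp_sub_lmmse_of_isRegular ho hv hz hreg q)

theorem estError_lmmsePolicy_le (ho : Measurable o) (hv : MemLp v 2 P) (hz : MemLp z 2 P)
    (hreg : IsRegular P z o γ)
    (hgauss : HasGaussianLaw (fun q => ((v q.1).ofLp, observation z q)) (jointLaw P ho γ))
    (hv0 : ∫ q, (v q.1).ofLp ∂(jointLaw P ho γ) = 0)
    (hobs0 : ∫ q, observation z q ∂(jointLaw P ho γ) = 0)
    (e : Policy (ℝ × Vec nz) (Vec n)) :
    estError P v z o γ (lmmsePolicy P v z o γ) ≤ estError P v z o γ e := by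
  have hvm := hv.aestronglyMeasurable.aemeasurable
  have hzm := hz.aestronglyMeasurable.aemeasurable
  have hyz : AEMeasurable (fun q : Ω × ℝ => (q.2, z q.1)) (jointLaw P ho γ) :=
    measurable_snd.aemeasurable.prodMk
      (hzm.comp_quasiMeasurePreserving (measurePreserving_fst_jointLaw ho γ).quasiMeasurePreserving)
  rw [estError_lmmsePolicy_eq_lintegral_jointLaw ho hvm hzm,
    estError_eq_lintegral_jointLaw ho hvm hzm]
  simpa only [sub_add_cancel] using lintegral_enorm_sq_le_of_indepFun hyz
    (indepFun_sub_lmmse_of_isRegular ho hv hz hreg hgauss hobs0) (memLp_sub_lmmse ho hv hz)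
    (integral_sub_lmmse_of_isRegular ho hv hz hreg hv0 hobs0) (measurable_lmmse P v z o γ) e.1

end Estimation

/-! ### The cost of the sender -/

section Sender

variable {Ω I : Type*} [MeasurableSpace Ω] [MeasurableSpace I] {P : Measure Ω} {o : Ω → I}
  {γ : Policy I ℝ} {nx nw nz : ℕ} {x : Ω → Vec nx} {w : Ω → Vec nw} {z : Ω → Vec nz} {δ : ℝ}

/-- The matrix `diag(-I, δ I)`: the cost of the sender is minus the trace of its product with the
second moment of the estimation errors of `(x, w)`. -/
def privacyWeight (nx nw : ℕ) (δ : ℝ) : Matrix (Fin nx ⊕ Fin nw) (Fin nx ⊕ Fin nw) ℝ :=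
  fromBlocks (-1) 0 0 (δ • 1)

theorem isHermitian_privacyWeight (nx nw : ℕ) (δ : ℝ) : (privacyWeight nx nw δ).IsHermitian := by
  rw [IsHermitian, privacyWeight, fromBlocks_conjTranspose]
  simp

theorem isHermitian_privacyMatrix (S : Matrix (Fin nx ⊕ Fin nw) (Fin nx ⊕ Fin nw) ℝ) (δ : ℝ) :
    (privacyMatrix S δ).IsHermitian :=
  isHermitian_sqrt_mul_mul_sqrt S (isHermitian_privacyWeight nx nw δ)

theorem trace_privacyWeight_mul (δ : ℝ) (M : Matrix (Fin nx ⊕ Fin nw) (Fin nx ⊕ Fin nw) ℝ) :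
    (privacyWeight nx nw δ * M).trace = δ * M.toBlocks₂₂.trace - M.toBlocks₁₁.trace := by
  have hM : (privacyWeight nx nw δ * M).trace =
      (-M.toBlocks₁₁).trace + (δ • M.toBlocks₂₂).trace := by
    conv_lhs => rw [← fromBlocks_toBlocks M, privacyWeight, fromBlocks_multiply]
    simp [trace, Fintype.sum_sum_type]
  rw [hM, trace_neg, trace_smul, smul_eq_mul, neg_add_eq_sub]

theorem single_dotProduct_privacyWeight_mulVec_neg (i : Fin nx) :
    (Pi.single (Sum.inl i) 1 : Fin nx ⊕ Fin nw → ℝ) ⬝ᵥ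
      privacyWeight nx nw δ *ᵥ Pi.single (Sum.inl i) 1 < 0 := by
  simp [privacyWeight]

theorem measurable_dotProduct_stackXW (hx : Measurable x) (hw : Measurable w)
    (K : Fin nx ⊕ Fin nw → ℝ) : Measurable fun ω => K ⬝ᵥ stackXW x w ω := by
  simp only [dotProduct, stackXW, Fintype.sum_sum_type, Sum.elim_inl, Sum.elim_inr]
  fun_prop

theorem memLp_stackXW {Q : Measure Ω} (hx : MemLp x 2 Q) (hw : MemLp w 2 Q) :
    MemLp (stackXW x w) 2 Q :=
  memLp_sumElim (memLp_ofLp hx) (memLp_ofLp hw)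

theorem Xi_eq_partialCov (hx : MemLp x 2 P) (hw : MemLp w 2 P) (hz : MemLp z 2 P)
    (hdet : IsUnit (secondMoment P (fun ω => (z ω).ofLp) (fun ω => (z ω).ofLp)).det) :
    Xi P x w z = partialCov P (stackXW x w) (stackXW x w) fun ω => (z ω).ofLp :=
  (partialCov_eq_schurComplement (memLp_stackXW hx hw) (memLp_stackXW hx hw) (memLp_ofLp hz)
    hdet).symm

variable [IsProbabilityMeasure P]

theorem errorMoment_of_isRegular {ι : Type*} [Fintype ι] {f : Ω → ι → ℝ} (ho : Measurable o)
    (hf : MemLp f 2 P) (hz : MemLp z 2 P)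
    (hdet : IsUnit (secondMoment P (fun ω => (z ω).ofLp) (fun ω => (z ω).ofLp)).det)
    (hreg : IsRegular P z o γ) :
    errorMoment P f z ho γ = partialCov P f f (fun ω => (z ω).ofLp) -
      partialCov (jointLaw P ho γ) (f ∘ Prod.fst) message ((fun ω => (z ω).ofLp) ∘ Prod.fst) *
        (partialCov (jointLaw P ho γ) message message ((fun ω => (z ω).ofLp) ∘ Prod.fst))⁻¹ *
        (partialCov (jointLaw P ho γ) (f ∘ Prod.fst) message
          ((fun ω => (z ω).ofLp) ∘ Prod.fst))ᵀ := by
  have hπ := measurePreserving_fst_jointLaw (P := P) ho γ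
  obtain ⟨hy, hs⟩ := (isRegular_iff ho hz hdet).1 hreg
  have hz' := memLp_ofLp hz
  rw [← secondMoment_comp_measurePreserving hπ hz' hz'] at hdet
  rw [errorMoment, if_pos hreg, ← partialCov_comp_measurePreserving hπ hf hf hz']
  exact partialCov_sumElim (hf.comp_measurePreserving hπ) (hf.comp_measurePreserving hπ) hy
    (hz'.comp_measurePreserving hπ) hdet hs

theorem senderCost_lmmsePolicy (ho : Measurable o) (hx : MemLp x 2 P) (hw : MemLp w 2 P)
    (hz : MemLp z 2 P) :
    senderCost P x w z o δ γ (lmmsePolicy P x z o γ) (lmmsePolicy P w z o γ) =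
      ((-(privacyWeight nx nw δ * errorMoment P (stackXW x w) z ho γ).trace : ℝ) : EReal) := by
  have hblock₁ : (errorMoment P (stackXW x w) z ho γ).toBlocks₁₁ =
      errorMoment P (fun ω => (x ω).ofLp) z ho γ := by
    unfold errorMoment
    split_ifs <;> rfl
  have hblock₂ : (errorMoment P (stackXW x w) z ho γ).toBlocks₂₂ =
      errorMoment P (fun ω => (w ω).ofLp) z ho γ := by
    unfold errorMoment
    split_ifs <;> rfl
  rw [senderCost, estError_lmmsePolicy ho hx hz, estError_lmmsePolicy ho hw hz,
    trace_privacyWeight_mul, neg_sub, hblock₁, hblock₂, EReal.coe_ennreal_ofReal,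
    EReal.coe_ennreal_ofReal,
    max_eq_left (posSemidef_errorMoment ho (memLp_ofLp hx) hz).trace_nonneg,
    max_eq_left (posSemidef_errorMoment ho (memLp_ofLp hw) hz).trace_nonneg]
  norm_cast

theorem le_trace_privacyWeight_mul_Xi_sub_errorMoment (hnx : 0 < nx) (ho : Measurable o)
    (hx : MemLp x 2 P) (hw : MemLp w 2 P) (hz : MemLp z 2 P)
    (hdet : IsUnit (secondMoment P (fun ω => (z ω).ofLp) (fun ω => (z ω).ofLp)).det)
    (hXi : (Xi P x w z).PosDef) {l : ℝ}
    (hl : l ∈ lowerBounds {m : ℝ |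
      Module.End.HasEigenvalue (Matrix.toLin' (privacyMatrix (Xi P x w z) δ)) m}) :
    l ≤ (privacyWeight nx nw δ *
      (Xi P x w z - errorMoment P (stackXW x w) z ho γ)).trace := by
  have hl0 : l < 0 := neg_of_dotProduct_mulVec_neg hXi (isHermitian_privacyWeight nx nw δ) hl
    (single_dotProduct_privacyWeight_mulVec_neg ⟨0, hnx⟩)
  have hU := memLp_stackXW hx hw
  have hz' := memLp_ofLp hz
  have hXi' := Xi_eq_partialCov hx hw hz hdet
  by_cases hreg : IsRegular P z o γ
  · have hπ := measurePreserving_fst_jointLaw (P := P) ho γ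
    obtain ⟨hy, hs⟩ := (isRegular_iff ho hz hdet).1 hreg
    have hblock := fromBlocks_partialCov_posSemidef (hU.comp_measurePreserving hπ) hy
      (hz'.comp_measurePreserving hπ)
    rw [partialCov_comp_measurePreserving hπ hU hU hz', ← hXi'] at hblock
    rw [errorMoment_of_isRegular ho hU hz hdet hreg, ← hXi', sub_sub_cancel]
    refine le_trace_mul_mul_inv_mul_transpose hXi (isHermitian_privacyWeight nx nw δ) hl hl0.le
      hblock (lt_of_le_of_ne ?_ ?_)
    · exact hblock.diag_nonneg (i := Sum.inr ())
    · rw [det_unique] at hs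
      exact hs.ne_zero.symm
  · rw [errorMoment, if_neg hreg, ← hXi', sub_self, Matrix.mul_zero, trace_zero]
    exact hl0.le

end Sender

/-! ### Linear messages and the equilibrium -/

section LinearMessage

variable {Ω I : Type*} [MeasurableSpace Ω] [MeasurableSpace I] {P : Measure Ω} {o : Ω → I}
  {ho : Measurable o} {γ : Policy I ℝ} {n nz : ℕ} {ι κ : Type*} [Fintype ι] [Fintype κ]
  {f : Ω → κ → ℝ} {u : Ω → ι → ℝ} {K : ι → ℝ} {z : Ω → Vec nz}

theorem message_ae_eq_mulVec (hγ : ∀ᵐ q ∂(jointLaw P ho γ), q.2 = K ⬝ᵥ u q.1) :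
    message =ᵐ[jointLaw P ho γ] fun q => replicateRow Unit K *ᵥ (u ∘ Prod.fst) q := by
  filter_upwards [hγ] with q hq
  exact funext fun _ => hq

variable [IsProbabilityMeasure P]

theorem estError_lmmsePolicy_le_of_hasGaussianLaw {E : Type*} [NormedAddCommGroup E]
    [NormedSpace ℝ E] [CompleteSpace E] [SecondCountableTopology E] [MeasurableSpace E]
    [BorelSpace E] {T : Ω → E} (hT : HasGaussianLaw T P) (hT0 : ∫ ω, T ω ∂P = 0)
    (ho : Measurable o) (L : E →L[ℝ] Vec n) (M : E →L[ℝ] Vec nz) (ℓ : E →L[ℝ] ℝ)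
    (hreg : IsRegular P (fun ω => M (T ω)) o γ)
    (hγ : ∀ᵐ q ∂(jointLaw P ho γ), q.2 = ℓ (T q.1)) (e : Policy (ℝ × Vec nz) (Vec n)) :
    estError P (fun ω => L (T ω)) (fun ω => M (T ω)) o γ
        (lmmsePolicy P (fun ω => L (T ω)) (fun ω => M (T ω)) o γ) ≤
      estError P (fun ω => L (T ω)) (fun ω => M (T ω)) o γ e := by
  have hπ := measurePreserving_fst_jointLaw (P := P) ho γ
  have hTfst := hasGaussianLaw_comp_measurePreserving hT hπ
  have hTfst0 : ∫ q, (T ∘ Prod.fst) q ∂(jointLaw P ho γ) = 0 :=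
    (integral_comp_measurePreserving hT.memLp_two.1 hπ).trans hT0
  let obs : E →L[ℝ] (Unit ⊕ Fin nz → ℝ) :=
    .pi (Sum.rec (fun _ => ℓ) fun j => (EuclideanSpace.proj j).comp M)
  let est : E →L[ℝ] (Fin n → ℝ) := .pi fun i => (EuclideanSpace.proj i).comp L
  have hobs : ∀ᵐ q ∂(jointLaw P ho γ), obs (T q.1) = observation (fun ω => M (T ω)) q := by
    filter_upwards [hγ] with q hq
    ext (_ | j)
    · exact hq.symm
    · rfl
  have hint : ∀ {F : Type} [NormedAddCommGroup F] [NormedSpace ℝ F] [CompleteSpace F]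
      (A : E →L[ℝ] F), ∫ q, A ((T ∘ Prod.fst) q) ∂(jointLaw P ho γ) = 0 := fun A => by
    rw [A.integral_comp_comm hTfst.integrable, hTfst0, map_zero]
  refine estError_lmmsePolicy_le ho (hT.map_fun L).memLp_two (hT.map_fun M).memLp_two hreg
    ((hTfst.map_fun (est.prod obs)).congr ?_) (hint est) ?_ e
  · filter_upwards [hobs] with q hq
    exact Prod.ext rfl hq
  · exact (integral_congr_ae hobs).symm.trans (hint obs)

theorem partialCov_message_right (hf : MemLp f 2 P) (hu : MemLp u 2 P) (hz : MemLp z 2 P)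
    (hγ : ∀ᵐ q ∂(jointLaw P ho γ), q.2 = K ⬝ᵥ u q.1) :
    partialCov (jointLaw P ho γ) (f ∘ Prod.fst) message ((fun ω => (z ω).ofLp) ∘ Prod.fst) =
      partialCov P f u (fun ω => (z ω).ofLp) * (replicateRow Unit K)ᵀ := by
  have hπ := measurePreserving_fst_jointLaw (P := P) ho γ
  rw [partialCov_congr .rfl (message_ae_eq_mulVec hγ), partialCov_mulVec_right _
    (hf.comp_measurePreserving hπ) (hu.comp_measurePreserving hπ)
    ((memLp_ofLp hz).comp_measurePreserving hπ),
    partialCov_comp_measurePreserving hπ hf hu (memLp_ofLp hz)]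

theorem partialCov_message_self (hu : MemLp u 2 P) (hz : MemLp z 2 P)
    (hγ : ∀ᵐ q ∂(jointLaw P ho γ), q.2 = K ⬝ᵥ u q.1) :
    partialCov (jointLaw P ho γ) message message ((fun ω => (z ω).ofLp) ∘ Prod.fst) () () =
      K ⬝ᵥ partialCov P u u (fun ω => (z ω).ofLp) *ᵥ K := by
  have hπ := measurePreserving_fst_jointLaw (P := P) ho γ
  have hy := message_ae_eq_mulVec hγ
  rw [partialCov_congr hy .rfl, partialCov_mulVec_left _ (hu.comp_measurePreserving hπ)
    ((memLp_congr_ae hy).2 (memLp_mulVec _ (hu.comp_measurePreserving hπ)))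
    ((memLp_ofLp hz).comp_measurePreserving hπ), partialCov_message_right hu hu hz hγ]
  rfl

theorem isRegular_of_ae_eq_dotProduct (hu : MemLp u 2 P) (hz : MemLp z 2 P)
    (hdet : IsUnit (secondMoment P (fun ω => (z ω).ofLp) (fun ω => (z ω).ofLp)).det)
    (hγ : ∀ᵐ q ∂(jointLaw P ho γ), q.2 = K ⬝ᵥ u q.1)
    (hK : K ⬝ᵥ partialCov P u u (fun ω => (z ω).ofLp) *ᵥ K ≠ 0) : IsRegular P z o γ := by
  have hπ := measurePreserving_fst_jointLaw (P := P) ho γ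
  refine (isRegular_iff ho hz hdet).2 ⟨(memLp_congr_ae (message_ae_eq_mulVec hγ)).2
    (memLp_mulVec _ (hu.comp_measurePreserving hπ)), ?_⟩
  rw [det_unique, isUnit_iff_ne_zero]
  exact (partialCov_message_self hu hz hγ).trans_ne hK

end LinearMessage

section Equilibrium

variable {Ω I : Type*} [MeasurableSpace Ω] [MeasurableSpace I] {P : Measure Ω}
  {o : Ω → I} {γ : Policy I ℝ} {nx nw nz : ℕ}
  {x : Ω → Vec nx} {w : Ω → Vec nw} {z : Ω → Vec nz} {δ : ℝ}

theorem integral_eq_zero_of_stackXWZ (hint : Integrable (fun ω => (x ω, w ω, z ω)) P)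
    (h : ∀ i, ∫ ω, stackXWZ x w z ω i ∂P = 0) : ∫ ω, (x ω, w ω, z ω) ∂P = 0 := by
  have hvec : ∀ {n : ℕ} {v : Ω → Vec n}, Integrable v P → (∀ i, ∫ ω, v ω i ∂P = 0) →
      ∫ ω, v ω ∂P = 0 := fun hv h0 => by
    ext i
    exact ((EuclideanSpace.proj (𝕜 := ℝ) i).integral_comp_comm hv).symm.trans (h0 i)
  rw [integral_pair hint.fst hint.snd, integral_pair hint.snd.fst hint.snd.snd,
    hvec hint.fst fun i => h (.inl (.inl i)), hvec hint.snd.fst fun i => h (.inl (.inr i)),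
    hvec hint.snd.snd fun i => h (.inr i)]
  rfl

theorem posDef_Xi (hcov : (secondMoment P (stackXWZ x w z) (stackXWZ x w z)).PosDef) :
    (Xi P x w z).PosDef := by
  refine posDef_schurComplement ?_
  rw [secondMoment_transpose]
  convert hcov using 1
  exact (secondMoment_sumElim P _ _).symm

theorem isUnit_det_secondMoment_of_posDef_stackXWZ
    (hcov : (secondMoment P (stackXWZ x w z) (stackXWZ x w z)).PosDef) :
    IsUnit (secondMoment P (fun ω => (z ω).ofLp) (fun ω => (z ω).ofLp)).det :=
  isUnit_iff_ne_zero.2 (hcov.submatrix (e := Sum.inr) Sum.inr_injective).det_pos.ne'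

theorem exists_continuousLinearMap_eq_dotProduct_sumElim (K : Fin nx ⊕ Fin nw → ℝ) :
    ∃ ℓ : Vec nx × Vec nw × Vec nz →L[ℝ] ℝ, ∀ t, ℓ t = K ⬝ᵥ Sum.elim t.1.ofLp t.2.1.ofLp :=
  ⟨∑ i, K i • Sum.rec (fun i => (EuclideanSpace.proj i).comp (.fst ℝ _ _))
    (fun j => (EuclideanSpace.proj j).comp ((ContinuousLinearMap.fst ℝ _ _).comp (.snd ℝ _ _))) i,
    fun t => by simp [dotProduct]⟩

theorem scale_one (γ : Policy I ℝ) : scale 1 γ = γ :=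
  Subtype.ext <| by simpa only [scale, one_mul] using Kernel.map_id' γ.1

theorem ae_eq_const_mul_scale {g : Ω → ℝ} (k : ℝ)
    (h : ∀ᵐ ω ∂P, ∀ᵐ y ∂(γ.1 (o ω)), y = g ω) :
    ∀ᵐ ω ∂P, ∀ᵐ y ∂((scale k γ).1 (o ω)), y = k * g ω := by
  filter_upwards [h] with ω hω
  rw [scale, Kernel.map_apply _ (measurable_const_mul k),
    ae_map_iff (p := (· = k * g ω)) (by fun_prop) (measurableSet_singleton _)]
  exact hω.mono fun y hy => congrArg (k * ·) hy

theorem exists_policy_ae_eq_dotProduct (ho : Measurable o) {p : I → Vec nx × Vec nw}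
    (hp : Measurable p) (hpo : ∀ ω, p (o ω) = (x ω, w ω)) (K : Fin nx ⊕ Fin nw → ℝ) :
    ∃ γ : Policy I ℝ, (∀ᵐ ω ∂P, ∀ᵐ y ∂(γ.1 (o ω)), y = K ⬝ᵥ stackXW x w ω) ∧
      ∀ k, ∀ᵐ q ∂(jointLaw P ho (scale k γ)), q.2 = (k • K) ⬝ᵥ stackXW x w q.1 := by
  have hmeas := (measurable_dotProduct_stackXW measurable_fst measurable_snd K).comp hp
  have heq : ∀ ω, K ⬝ᵥ stackXW Prod.fst Prod.snd (p (o ω)) = K ⬝ᵥ stackXW x w ω := fun ω => by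
    rw [hpo]
    rfl
  let γ : Policy I ℝ := ⟨Kernel.deterministic _ hmeas, inferInstance⟩
  have hγ : ∀ ω, ∀ᵐ y ∂(γ.1 (o ω)), y = K ⬝ᵥ stackXW x w ω := fun ω => by
    rw [Kernel.deterministic_apply, ae_dirac_eq]
    exact heq ω
  refine ⟨γ, .of_forall hγ, fun k => ?_⟩
  simp only [smul_dotProduct, smul_eq_mul, ← heq] at hγ ⊢
  exact snd_ae_eq_jointLaw ho ((hmeas.comp ho).const_mul k)
    (ae_eq_const_mul_scale k (.of_forall hγ))

variable [IsProbabilityMeasure P]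

theorem trace_privacyWeight_mul_Xi_sub_errorMoment {K : Fin nx ⊕ Fin nw → ℝ} (ho : Measurable o)
    (hx : MemLp x 2 P) (hw : MemLp w 2 P) (hz : MemLp z 2 P)
    (hdet : IsUnit (secondMoment P (fun ω => (z ω).ofLp) (fun ω => (z ω).ofLp)).det)
    (hγ : ∀ᵐ q ∂(jointLaw P ho γ), q.2 = K ⬝ᵥ stackXW x w q.1)
    (hK : K ⬝ᵥ Xi P x w z *ᵥ K ≠ 0) :
    (privacyWeight nx nw δ * (Xi P x w z - errorMoment P (stackXW x w) z ho γ)).trace =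
      ((Xi P x w z *ᵥ K) ⬝ᵥ privacyWeight nx nw δ *ᵥ (Xi P x w z *ᵥ K)) /
        (K ⬝ᵥ Xi P x w z *ᵥ K) := by
  have hu := memLp_stackXW hx hw
  rw [Xi_eq_partialCov hx hw hz hdet] at hK ⊢
  rw [errorMoment_of_isRegular ho hu hz hdet (isRegular_of_ae_eq_dotProduct hu hz hdet hγ hK),
    sub_sub_cancel, trace_mul_mul_inv_mul_transpose, partialCov_message_self hu hz hγ,
    partialCov_message_right hu hu hz hγ]
  rfl

theorem trace_privacyWeight_mul_Xi_sub_errorMoment_eq {ξ : Fin nx ⊕ Fin nw → ℝ} {k l : ℝ}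
    (ho : Measurable o) (hx : MemLp x 2 P) (hw : MemLp w 2 P) (hz : MemLp z 2 P)
    (hdet : IsUnit (secondMoment P (fun ω => (z ω).ofLp) (fun ω => (z ω).ofLp)).det)
    (hXi : (Xi P x w z).PosDef) (hunit : ξ ⬝ᵥ ξ = 1)
    (hξ : Module.End.HasEigenvector (Matrix.toLin' (privacyMatrix (Xi P x w z) δ)) l ξ)
    (hk : k ≠ 0)
    (hγ : ∀ᵐ q ∂(jointLaw P ho γ),
      q.2 = (k • (CFC.sqrt (Xi P x w z))⁻¹ *ᵥ ξ) ⬝ᵥ stackXW x w q.1) :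
    (privacyWeight nx nw δ * (Xi P x w z - errorMoment P (stackXW x w) z ho γ)).trace = l := by
  have hvar := smul_inv_sqrt_mulVec_dotProduct_mulVec hXi k ξ
  rw [hunit, mul_one] at hvar
  have hk2 : k * k ≠ 0 := mul_self_ne_zero.2 hk
  have hl : (CFC.sqrt (Xi P x w z) *ᵥ ξ) ⬝ᵥ
      privacyWeight nx nw δ *ᵥ (CFC.sqrt (Xi P x w z) *ᵥ ξ) = l :=
    dotProduct_mulVec_sqrt_mulVec_eq hunit hξ
  rw [trace_privacyWeight_mul_Xi_sub_errorMoment ho hx hw hz hdet hγ (hvar ▸ hk2), hvar,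
    mulVec_smul, mulVec_inv_sqrt_mulVec hXi, mulVec_smul, smul_dotProduct, dotProduct_smul, hl,
    smul_eq_mul, smul_eq_mul, ← mul_assoc, mul_div_cancel_left₀ _ hk2]

theorem isRegular_of_inv_sqrt_mulVec {ξ : Fin nx ⊕ Fin nw → ℝ} {k : ℝ} (ho : Measurable o)
    (hx : MemLp x 2 P) (hw : MemLp w 2 P) (hz : MemLp z 2 P)
    (hdet : IsUnit (secondMoment P (fun ω => (z ω).ofLp) (fun ω => (z ω).ofLp)).det)
    (hXi : (Xi P x w z).PosDef) (hξ : ξ ⬝ᵥ ξ = 1) (hk : k ≠ 0)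
    (hγ : ∀ᵐ q ∂(jointLaw P ho γ),
      q.2 = (k • (CFC.sqrt (Xi P x w z))⁻¹ *ᵥ ξ) ⬝ᵥ stackXW x w q.1) : IsRegular P z o γ := by
  refine isRegular_of_ae_eq_dotProduct (memLp_stackXW hx hw) hz hdet hγ ?_
  rw [← Xi_eq_partialCov hx hw hz hdet, smul_inv_sqrt_mulVec_dotProduct_mulVec hXi, hξ, mul_one]
  exact mul_self_ne_zero.2 hk

theorem isEquilibrium_lmmsePolicy (hnx : 0 < nx) (ho : Measurable o)
    (hGauss : HasGaussianLaw (fun ω => (x ω, w ω, z ω)) P)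
    (hmean : ∫ ω, (x ω, w ω, z ω) ∂P = 0)
    (hdet : IsUnit (secondMoment P (fun ω => (z ω).ofLp) (fun ω => (z ω).ofLp)).det)
    (hXi : (Xi P x w z).PosDef) {ξ : Fin nx ⊕ Fin nw → ℝ}
    (hξ : IsNormalizedMinEigenvector (privacyMatrix (Xi P x w z) δ) ξ) {k : ℝ} (hk : k ≠ 0)
    (hγ : ∀ᵐ q ∂(jointLaw P ho γ),
      q.2 = (k • (CFC.sqrt (Xi P x w z))⁻¹ *ᵥ ξ) ⬝ᵥ stackXW x w q.1) :
    IsEquilibrium P x w z o δ (lmmsePolicy P x z o) (lmmsePolicy P w z o) γ := by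
  obtain ⟨hunit, l, hl, hξl⟩ := hξ
  have hx : MemLp x 2 P := hGauss.fst.memLp_two
  have hw : MemLp w 2 P := hGauss.snd.fst.memLp_two
  have hz : MemLp z 2 P := hGauss.snd.snd.memLp_two
  have hreg := isRegular_of_inv_sqrt_mulVec ho hx hw hz hdet hXi hunit hk hγ
  obtain ⟨ℓ, hℓ⟩ := exists_continuousLinearMap_eq_dotProduct_sumElim (nz := nz)
    (k • (CFC.sqrt (Xi P x w z))⁻¹ *ᵥ ξ)
  have hγℓ : ∀ᵐ q ∂(jointLaw P ho γ), q.2 = ℓ (x q.1, w q.1, z q.1) :=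
    hγ.mono fun q hq => hq.trans (hℓ (x q.1, w q.1, z q.1)).symm
  refine ⟨?_, ?_, fun ψ' => ?_, fun φ' => ?_, fun γ' => ?_⟩
  · exact estError_lmmsePolicy ho hx hz ▸ ENNReal.ofReal_ne_top
  · exact estError_lmmsePolicy ho hw hz ▸ ENNReal.ofReal_ne_top
  · exact estError_lmmsePolicy_le_of_hasGaussianLaw hGauss hmean ho (.fst ℝ _ _)
      ((ContinuousLinearMap.snd ℝ _ _).comp (.snd ℝ _ _)) ℓ hreg hγℓ _
  · exact estError_lmmsePolicy_le_of_hasGaussianLaw hGauss hmean ho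
      ((ContinuousLinearMap.fst ℝ _ _).comp (.snd ℝ _ _))
      ((ContinuousLinearMap.snd ℝ _ _).comp (.snd ℝ _ _)) ℓ hreg hγℓ _
  · have hle := (trace_privacyWeight_mul_Xi_sub_errorMoment_eq ho hx hw hz hdet hXi hunit hξl hk
      hγ).trans_le (le_trace_privacyWeight_mul_Xi_sub_errorMoment hnx ho hx hw hz hdet hXi hl.2
        (γ := γ'))
    rw [Matrix.mul_sub, Matrix.mul_sub, trace_sub, trace_sub, sub_le_sub_iff_left] at hle
    rw [senderCost_lmmsePolicy ho hx hw hz, senderCost_lmmsePolicy ho hx hw hz]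
    exact EReal.coe_le_coe_iff.2 (neg_le_neg hle)

end Equilibrium

end PrivacyGame

end

open PrivacyGame in
theorem corollary1_general
    {Ω I : Type*} [MeasurableSpace Ω] [MeasurableSpace I]
    (P : Measure Ω) [IsProbabilityMeasure P]
    {nx nw nz : ℕ} (hnx : 0 < nx)
    (x : Ω → Vec nx) (w : Ω → Vec nw) (z : Ω → Vec nz)
    (hGauss : HasGaussianLaw (fun ω => (x ω, w ω, z ω)) P)
    (hmean : ∀ i, ∫ ω, stackXWZ x w z ω i ∂P = 0)
    (hcov : (secondMoment P (stackXWZ x w z) (stackXWZ x w z)).PosDef)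
    (o : Ω → I) (ho : Measurable o)
    (p : I → Vec nx × Vec nw) (hp : Measurable p) (hpo : ∀ ω, p (o ω) = (x ω, w ω))
    (δ : ℝ) :
    (∃ ξ, IsNormalizedMinEigenvector (privacyMatrix (Xi P x w z) δ) ξ) ∧
    ∀ ξ, IsNormalizedMinEigenvector (privacyMatrix (Xi P x w z) δ) ξ →
      ∃ (ψ : Policy I ℝ → Policy (ℝ × Vec nz) (Vec nx))
        (φ : Policy I ℝ → Policy (ℝ × Vec nz) (Vec nw)) (γ : Policy I ℝ),
        IsEquilibrium P x w z o δ ψ φ γ ∧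
        (∀ γ' : Policy I ℝ, ∀ᵐ ω ∂P, ∀ᵐ y ∂(γ'.1 (o ω)),
          ∀ᵐ xh ∂((ψ γ').1 (y, z ω)), xh = lmmse P x z o γ' (y, z ω)) ∧
        (∀ γ' : Policy I ℝ, ∀ᵐ ω ∂P, ∀ᵐ y ∂(γ'.1 (o ω)),
          ∀ᵐ wh ∂((φ γ').1 (y, z ω)), wh = lmmse P w z o γ' (y, z ω)) ∧
        IsRegular P z o γ ∧
        (∀ᵐ ω ∂P, ∀ᵐ y ∂(γ.1 (o ω)),
          y = ((CFC.sqrt (Xi P x w z))⁻¹.mulVec ξ) ⬝ᵥ stackXW x w ω) ∧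
        ∀ k : ℝ, k ≠ 0 → IsEquilibrium P x w z o δ ψ φ (scale k γ) := by
  have hdet := isUnit_det_secondMoment_of_posDef_stackXWZ hcov
  have hXi := posDef_Xi hcov
  have hmean0 := integral_eq_zero_of_stackXWZ hGauss.integrable hmean
  have : Nonempty (Fin nx ⊕ Fin nw) := ⟨.inl ⟨0, hnx⟩⟩
  refine ⟨exists_isNormalizedMinEigenvector (isHermitian_privacyMatrix _ δ), fun ξ hξ => ?_⟩
  obtain ⟨γ, hγ, hscale⟩ := exists_policy_ae_eq_dotProduct (P := P) ho hp hpo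
    ((CFC.sqrt (Xi P x w z))⁻¹.mulVec ξ)
  have hequi := fun k (hk : k ≠ 0) =>
    isEquilibrium_lmmsePolicy hnx ho hGauss hmean0 hdet hXi hξ hk (hscale k)
  have hreg := isRegular_of_inv_sqrt_mulVec ho hGauss.fst.memLp_two hGauss.snd.fst.memLp_two
    hGauss.snd.snd.memLp_two hdet hXi hξ.1 one_ne_zero (hscale 1)
  rw [scale_one] at hreg
  exact ⟨lmmsePolicy P x z o, lmmsePolicy P w z o, γ, scale_one γ ▸ hequi 1 one_ne_zero,
    fun γ' => .of_forall fun ω => .of_forall fun y => ae_lmmsePolicy_eq P x z o γ' (y, z ω),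
    fun γ' => .of_forall fun ω => .of_forall fun y => ae_lmmsePolicy_eq P w z o γ' (y, z ω),
    hreg, hγ, hequi⟩

open PrivacyGame in
/-- `o` is what the sender observes: a random element that determines `(x, w)`, for instance
`o = (x, w)`, or `o = (x, w, z)` if the sender has access to the side information as well. -/
theorem corollary1
    {Ω I : Type*} [MeasurableSpace Ω] [MeasurableSpace I]
    (P : Measure Ω) [IsProbabilityMeasure P]
    {nx nw nz : ℕ} (hnx : 0 < nx)
    (x : Ω → Vec nx) (w : Ω → Vec nw) (z : Ω → Vec nz)
    (hx : Measurable x) (hw : Measurable w) (hz : Measurable z)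
    (hGauss : HasGaussianLaw (fun ω => (x ω, w ω, z ω)) P)
    (hmean : ∀ i, ∫ ω, stackXWZ x w z ω i ∂P = 0)
    (hcov : (secondMoment P (stackXWZ x w z) (stackXWZ x w z)).PosDef)
    (o : Ω → I) (ho : Measurable o)
    (p : I → Vec nx × Vec nw) (hp : Measurable p) (hpo : ∀ ω, p (o ω) = (x ω, w ω))
    (δ : ℝ) (hδ : 0 ≤ δ) :
    (∃ ξ, IsNormalizedMinEigenvector (privacyMatrix (Xi P x w z) δ) ξ) ∧
    ∀ ξ, IsNormalizedMinEigenvector (privacyMatrix (Xi P x w z) δ) ξ →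
      ∃ (ψ : Policy I ℝ → Policy (ℝ × Vec nz) (Vec nx))
        (φ : Policy I ℝ → Policy (ℝ × Vec nz) (Vec nw)) (γ : Policy I ℝ),
        IsEquilibrium P x w z o δ ψ φ γ ∧
        (∀ γ' : Policy I ℝ, ∀ᵐ ω ∂P, ∀ᵐ y ∂(γ'.1 (o ω)),
          ∀ᵐ xh ∂((ψ γ').1 (y, z ω)), xh = lmmse P x z o γ' (y, z ω)) ∧
        (∀ γ' : Policy I ℝ, ∀ᵐ ω ∂P, ∀ᵐ y ∂(γ'.1 (o ω)),
          ∀ᵐ wh ∂((φ γ').1 (y, z ω)), wh = lmmse P w z o γ' (y, z ω)) ∧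
        IsRegular P z o γ ∧
        (∀ᵐ ω ∂P, ∀ᵐ y ∂(γ.1 (o ω)),
          y = ((CFC.sqrt (Xi P x w z))⁻¹.mulVec ξ) ⬝ᵥ stackXW x w ω) ∧
        ∀ k : ℝ, k ≠ 0 → IsEquilibrium P x w z o δ ψ φ (scale k γ) :=
  corollary1_general P hnx x w z hGauss hmean hcov o ho p hp hpo δ
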